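/- Let $n\ge 2$, let $\mathcal K^n$ be the space of convex bodies (nonempty compact convex subsets) of $\mathbb R^n$ with the Hausdorff metric, and let $\mathcal R^n$ be the convex ring, i.e. the family of all finite (possibly empty) unions of convex bodies. For $A\in\mathcal R^n$ let $N(A)$ be the minimal number $k$ such that $A$ is a union of $k$ convex bodies (so $N(\emptyset)=0$). The extended convex ring is $\mathcal S^n=\{F\subset\mathbb R^n: F\cap rB^n\in\mathcal R^n\text{ for all }r>0\}$, where $B^n$ is the closed unit ball. Let $\mathrm{Val}$ be the set of all continuous translation invariant functions $\varphi:\mathcal K^n\to\mathbb R$ that are valuations, i.e. $\varphi(K\cup M)+\varphi(K\cap M)=\varphi(K)+\varphi(M)$ whenever $K,M,K\cup M\in\mathcal K^n$. Let $C=[0,1]^n$, $C_0=[0,1)^n$ and $\partial^+C=C\setminus C_0$. Let $Z$ be a stationary random closed set in $\mathbb R^n$ (a random element of the space of closed sets with the Borel $\sigma$-algebra of the hit-or-miss topology, such that $Z+t$ has the same distribution as $Z$ for all $t\in\mathbb R^n$) which almost surely has values in $\mathcal S^n$ and satisfies $\mathbb E\,2^{N(Z\cap B^n)}<\infty$. Let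 $\varphi\in\mathrm{Val}$. Then $\varphi$ has an additive extension to $\mathcal R^n$, again denoted by $\varphi$: that is, $\varphi(\emptyset)=0$ and $\varphi(A\cup B)+\varphi(A\cap B)=\varphi(A)+\varphi(B)$ for all $A,B\in\mathcal R^n$. The random variables $\varphi(Z\cap W)$, for all $W\in\mathcal K^n$, and $$\varphi(Z\cap C_0):=\varphi(Z\cap C)-\varphi(Z\cap\partial^+C)$$ are integrable. For every $K\in\mathcal K^n$ with volume $V_n(K)>0$, the limit $$\overline\varphi(Z)=\lim_{r\to\infty}\frac{1}{V_n(rK)}\,\mathbb E\,\varphi(Z\cap rK)$$ exists and is independent of $K$; moreover $$\overline\varphi(Z)=\mathbb E\,\varphi(Z\cap C_0).$$ -/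

import Mathlib

open MeasureTheory TopologicalSpace Filter Topology Set
open scoped ENNReal Pointwise

noncomputable section

/-- `ℝⁿ` with its Euclidean structure. -/
abbrev Euc (n : ℕ) : Type := EuclideanSpace ℝ (Fin n)

/-- `φ ∈ Val`: a translation invariant valuation on the (nonempty) convex bodies of `ℝⁿ`,
continuous with respect to the Hausdorff metric (the metric of `ConvexBody`). -/
structure IsVal {n : ℕ} (φ : ConvexBody (Euc n) → ℝ) : Prop where
  additive : ∀ K M U I : ConvexBody (Euc n),
    (U : Set (Euc n)) = (K : Set (Euc n)) ∪ (M : Set (Euc n)) →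
    (I : Set (Euc n)) = (K : Set (Euc n)) ∩ (M : Set (Euc n)) →
    φ U + φ I = φ K + φ M
  translation_invariant : ∀ (K L : ConvexBody (Euc n)) (t : Euc n),
    (L : Set (Euc n)) = (fun x => x + t) '' (K : Set (Euc n)) → φ L = φ K
  continuous : Continuous φ

/-- `A` is the union of `k` convex bodies. -/
def IsUnionOfBodies {n : ℕ} (A : Set (Euc n)) (k : ℕ) : Prop :=
  ∃ K : Fin k → ConvexBody (Euc n), A = ⋃ i, (K i : Set (Euc n))

/-- The convex ring: finite (possibly empty) unions of convex bodies. -/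
def convexRing (n : ℕ) : Set (Set (Euc n)) :=
  {A | ∃ k : ℕ, IsUnionOfBodies A k}

/-- The minimal number `N(A)` of convex bodies with union `A`, for `A` in the convex ring. -/
def minBodies {n : ℕ} (A : Set (Euc n)) : ℕ :=
  sInf {k : ℕ | IsUnionOfBodies A k}

/-- The extended convex ring: (closed) sets `F` such that `F ∩ r Bⁿ` is in the convex ring for
all `r > 0`. -/
def extendedConvexRing (n : ℕ) : Set (Set (Euc n)) :=
  {F | ∀ r : ℝ, 0 < r → F ∩ Metric.closedBall (0 : Euc n) r ∈ convexRing n}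

/-- `ψ` is an additive extension of `φ` to the convex ring, with value `0` at the empty set.
(The values of `ψ` outside of the convex ring play no role.) -/
structure IsAdditiveExtension {n : ℕ} (φ : ConvexBody (Euc n) → ℝ) (ψ : Set (Euc n) → ℝ) :
    Prop where
  empty : ψ ∅ = 0
  extends_body : ∀ K : ConvexBody (Euc n), ψ (K : Set (Euc n)) = φ K
  additive : ∀ A ∈ convexRing n, ∀ B ∈ convexRing n, ψ (A ∪ B) + ψ (A ∩ B) = ψ A + ψ B

open Classical in
/-- The additive extension of `φ` to the convex ring (`0` if there is none). -/
def convexRingExt {n : ℕ} (φ : ConvexBody (Euc n) → ℝ) : Set (Euc n) → ℝ :=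
  if h : ∃ ψ : Set (Euc n) → ℝ, IsAdditiveExtension φ ψ then h.choose else 0

/-- The closed unit cube `C = [0,1]ⁿ`. -/
def unitCube (n : ℕ) : Set (Euc n) := {x | ∀ i, 0 ≤ x i ∧ x i ≤ 1}

/-- The half-open unit cube `C₀ = [0,1)ⁿ`. -/
def halfOpenCube (n : ℕ) : Set (Euc n) := {x | ∀ i, 0 ≤ x i ∧ x i < 1}

/-- The upper right boundary `∂⁺C = C \ C₀` of the unit cube. -/
def upperRightBoundary (n : ℕ) : Set (Euc n) := unitCube n \ halfOpenCube n

/-- `φ(F ∩ C₀) := φ(F ∩ C) - φ(F ∩ ∂⁺C)`, where `φ` is extended to the convex ring. -/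
def valueOnHalfOpenCube {n : ℕ} (φ : ConvexBody (Euc n) → ℝ) (F : Set (Euc n)) : ℝ :=
  convexRingExt φ (F ∩ unitCube n) - convexRingExt φ (F ∩ upperRightBoundary n)

/-- The hit-or-miss (Fell) topology on the closed subsets of `ℝⁿ`. -/
abbrev hitOrMissTopology (n : ℕ) : TopologicalSpace (Closeds (Euc n)) :=
  TopologicalSpace.generateFrom
    ({𝒰 | ∃ C : Set (Euc n), IsCompact C ∧
        𝒰 = {F : Closeds (Euc n) | (F : Set (Euc n)) ∩ C = ∅}} ∪
     {𝒰 | ∃ G : Set (Euc n), IsOpen G ∧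
        𝒰 = {F : Closeds (Euc n) | ((F : Set (Euc n)) ∩ G).Nonempty}})

/-- The closed subsets of `ℝⁿ` carry the Borel σ-algebra of the hit-or-miss topology. -/
instance closedsMeasurableSpace (n : ℕ) : MeasurableSpace (Closeds (Euc n)) :=
  @borel (Closeds (Euc n)) (hitOrMissTopology n)

/-- The translate `F + t` of a closed set. -/
def translateClosed {n : ℕ} (t : Euc n) (F : Closeds (Euc n)) : Closeds (Euc n) :=
  ⟨(fun x => x + t) '' (F : Set (Euc n)), (Homeomorph.addRight t).isClosedMap _ F.isClosed⟩

/-- `Z` is a stationary random closed set in `ℝⁿ`: a random element of the space of closed sets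
such that `Z + t` has the same distribution as `Z`, for every `t`. -/
structure IsStationaryRandomClosedSet {n : ℕ} {Ω : Type*} [MeasurableSpace Ω] (P : Measure Ω)
    (Z : Ω → Closeds (Euc n)) : Prop where
  measurable : Measurable Z
  stationary : ∀ t : Euc n, P.map (fun ω => translateClosed t (Z ω)) = P.map Z

end

/-! The extension rests on Groemer's theorem: if a linear combination of indicator functions of
compact convex sets vanishes, so does the same combination of the values of `φ`. Hence `φ` is
induced by a linear functional `Λ` on functions, and `A ↦ Λ (A.indicator 1)` is an additive
extension. Inclusion-exclusion expresses its value at a union of bodies through the values of `φ` at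
their intersections.

By the Blaschke selection theorem and continuity, `φ` is bounded by some `c` on bodies inside a unit
ball, uniformly over its translates. A union of `N` bodies has at most `2 ^ N` intersections, so
inside a unit ball the extension is at most `c * 2 ^ N` in absolute value. The moment hypothesis and
stationarity turn this into integrability on every convex window, with bounds that depend only on
the number of covering unit balls (`exists_integral_bound`).

For the limit, the half-open lattice cubes partition space, so the expectation on `r • K` is a sum
over the cubes that meet `r • K`. By stationarity, each cube contained in `r • K` contributes
exactly the expectation `m` for the half-open unit cube; every other cube contributes a bounded
amount. The contained cubes and the meeting cubes number at least `(r - a) ^ n` and at most `(r + a)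
^ n` times the volume of `K`, so the boundary cubes are negligible and the quotient tends to `m`.

Measurability is the remaining point: the convex ring is Borel among the compact sets, and the
extension is Borel on it. -/

/-! ### Groemer's theorem for compact convex sets. -/

section Groemer

variable {E : Type*} [NormedAddCommGroup E] [NormedSpace ℝ E]

/-- A compact convex set, possibly empty. -/
def CompactConvex (A : Set E) : Prop := IsCompact A ∧ Convex ℝ A

theorem CompactConvex.empty : CompactConvex (∅ : Set E) := ⟨isCompact_empty, convex_empty⟩

theorem CompactConvex.inter {A B : Set E} (hA : CompactConvex A) (hB : CompactConvex B) :
    CompactConvex (A ∩ B) := ⟨hA.1.inter hB.1, hA.2.inter hB.2⟩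

theorem CompactConvex.inter_closed {A B : Set E} (hA : CompactConvex A) (hB : IsClosed B)
    (hB' : Convex ℝ B) : CompactConvex (A ∩ B) := ⟨hA.1.inter_right hB, hA.2.inter hB'⟩

theorem ConvexBody.compactConvex (K : ConvexBody E) : CompactConvex (K : Set E) :=
  ⟨K.isCompact, K.convex⟩

theorem CompactConvex.inter_biInter {ι : Type*} {A : Set E} (hA : CompactConvex A) (t : Finset ι)
    {S : ι → Set E} (hS : ∀ i ∈ t, CompactConvex (S i)) : CompactConvex (A ∩ ⋂ i ∈ t, S i) :=
  hA.inter_closed (isClosed_biInter fun i hi => (hS i hi).1.isClosed)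
    (convex_iInter₂ fun i hi => (hS i hi).2)

theorem CompactConvex.biInter {ι : Type*} {t : Finset ι} (ht : t.Nonempty)
    {S : ι → Set E} (hS : ∀ i ∈ t, CompactConvex (S i)) : CompactConvex (⋂ i ∈ t, S i) := by
  obtain ⟨j, hj⟩ := ht
  have := (hS j hj).inter_biInter t hS
  rwa [inter_eq_right.2 (show ⋂ i ∈ t, S i ⊆ S j from iInter₂_subset j hj)] at this

/-- A set function on the compact convex sets which vanishes at the empty set, is additive on
dissections by hyperplanes, and is continuous along decreasing sequences. -/
structure IsConvexContent (μ : Set E → ℝ) : Prop where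
  empty : μ ∅ = 0
  split : ∀ K, CompactConvex K → ∀ (l : StrongDual ℝ E) (c : ℝ),
    μ (K ∩ {x | l x ≤ c}) + μ (K ∩ {x | c ≤ l x}) = μ K + μ (K ∩ {x | l x = c})
  tendsto_iInter : ∀ K : ℕ → Set E, (∀ j, CompactConvex (K j)) → Antitone K →
    Tendsto (fun j => μ (K j)) atTop (𝓝 (μ (⋂ j, K j)))

theorem isClosed_halfSpace_le (l : StrongDual ℝ E) (c : ℝ) : IsClosed {x | l x ≤ c} :=
  isClosed_le l.continuous continuous_const

theorem CompactConvex.inter_le {A : Set E} (hA : CompactConvex A) (l : StrongDual ℝ E) (c : ℝ) :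
    CompactConvex (A ∩ {x | l x ≤ c}) :=
  hA.inter_closed (isClosed_halfSpace_le l c) (convex_halfSpace_le l.isLinear c)

theorem CompactConvex.inter_ge {A : Set E} (hA : CompactConvex A) (l : StrongDual ℝ E) (c : ℝ) :
    CompactConvex (A ∩ {x | c ≤ l x}) :=
  hA.inter_closed (isClosed_le continuous_const l.continuous) (convex_halfSpace_ge l.isLinear c)

theorem CompactConvex.inter_eq {A : Set E} (hA : CompactConvex A) (l : StrongDual ℝ E) (c : ℝ) :
    CompactConvex (A ∩ {x | l x = c}) :=
  hA.inter_closed (isClosed_eq l.continuous continuous_const) (convex_hyperplane l.isLinear c)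

theorem CompactConvex.inter_iInter_le {A : Set E} (hA : CompactConvex A) {ι : Type*}
    (p : ι → Prop) (l : ι → StrongDual ℝ E) (c : ι → ℝ) :
    CompactConvex (A ∩ ⋂ (j) (_ : p j), {x | l j x ≤ c j}) :=
  hA.inter_closed (isClosed_iInter fun _ => isClosed_iInter fun _ => isClosed_halfSpace_le _ _)
    (convex_iInter₂ fun j _ => convex_halfSpace_le (l j).isLinear _)

/-- A closed convex set is the intersection of countably many closed half-spaces that contain it in
their interior. -/
theorem exists_seq_halfSpace [SecondCountableTopology E] {K : Set E} (hK : CompactConvex K) :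
    ∃ (l : ℕ → StrongDual ℝ E) (c : ℕ → ℝ),
      (∀ j, ∀ x ∈ K, l j x < c j) ∧ ⋂ j, {x | l j x ≤ c j} = K := by
  by_cases hu : K = univ
  -- The complement is empty here and offers no separating functional to enumerate; a constant
  -- sequence of trivial half-spaces serves instead.
  · exact ⟨fun _ => 0, fun _ => 1, by simp, by simp [hu]⟩
  have h : ∀ x : ↥Kᶜ, ∃ (f : StrongDual ℝ E) (u : ℝ), (∀ a ∈ K, f a < u) ∧ u < f x :=
    fun x => geometric_hahn_banach_closed_point hK.2 hK.1.isClosed x.2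
  choose f u hf hfu using h
  -- Lindelöf: countably many of the open half-spaces already cover the complement of `K`.
  obtain ⟨T, hT, hTU⟩ := isOpen_iUnion_countable (fun x : ↥Kᶜ => {y | u x < f x y})
    fun x => isOpen_lt continuous_const (f x).continuous
  have hTK : ⋃ i ∈ T, {y | u i < f i y} = Kᶜ := by
    rw [hTU]
    ext y
    simp only [mem_iUnion, mem_ofPred_eq, mem_compl_iff]
    refine ⟨?_, fun hy => ⟨⟨y, hy⟩, hfu ⟨y, hy⟩⟩⟩
    rintro ⟨i, hi⟩ hy
    exact (hf i y hy).not_gt hi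
  have hne : T.Nonempty := by
    rw [nonempty_iff_ne_empty]
    rintro rfl
    apply hu
    simpa using hTK.symm
  obtain ⟨e, he⟩ := hT.exists_eq_range hne
  refine ⟨fun j => f (e j), fun j => u (e j), fun j => hf (e j), ?_⟩
  rw [← compl_inj_iff, ← hTK, he]
  ext y
  simp

variable {μ : Set E → ℝ}

/-- Multiplying by the indicator of `H` preserves a linear relation, so all the sets may be cut at
once. -/
theorem sum_mul_indicator_inter {X ι : Type*} {s : Finset ι} {α : ι → ℝ} {K : ι → Set X}
    (h0 : ∀ x, ∑ i ∈ s, α i * (K i).indicator 1 x = 0) (H : Set X) (x : X) :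
    ∑ i ∈ s, α i * (K i ∩ H).indicator 1 x = 0 := by
  by_cases hxH : x ∈ H
  · rw [← h0 x]
    exact Finset.sum_congr rfl fun i _ => by simp [inter_indicator_one, hxH]
  · exact Finset.sum_eq_zero fun i _ => by simp [hxH]

/-- The induction step in Groemer's theorem: one may cut with a half-space that contains one
of the sets in its interior. -/
theorem IsConvexContent.sum_eq_sum_inter_le (hμ : IsConvexContent μ) {ι : Type*} [DecidableEq ι]
    (s : Finset ι) (α : ι → ℝ) {j : ι} (hj : j ∈ s)
    (ih : ∀ L : ι → Set E, (∀ i, CompactConvex (L i)) →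
      (∀ x, ∑ i ∈ s.erase j, α i * (L i).indicator 1 x = 0) →
      ∑ i ∈ s.erase j, α i * μ (L i) = 0)
    (K : ι → Set E) (hK : ∀ i, CompactConvex (K i))
    (h0 : ∀ x, ∑ i ∈ s, α i * (K i).indicator 1 x = 0)
    (l : StrongDual ℝ E) (c : ℝ) (hl : ∀ x ∈ K j, l x < c) :
    ∑ i ∈ s, α i * μ (K i) = ∑ i ∈ s, α i * μ (K i ∩ {x | l x ≤ c}) := by
  -- On a set `H` that misses `K j` the term `j` drops out, and the shorter relation falls under the
  -- induction hypothesis.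
  have key : ∀ H : Set E, (∀ i, CompactConvex (K i ∩ H)) → K j ∩ H = ∅ →
      ∑ i ∈ s, α i * μ (K i ∩ H) = 0 := by
    intro H hH hjH
    rw [← Finset.add_sum_erase _ _ hj, hjH, hμ.empty, mul_zero, zero_add]
    refine ih _ hH fun x => ?_
    have hx := sum_mul_indicator_inter h0 H x
    rwa [← Finset.add_sum_erase _ _ hj, hjH, indicator_empty, mul_zero, zero_add] at hx
  have h1 := key {x | c ≤ l x} (fun i => (hK i).inter_ge l c) (by
    ext x
    simp only [mem_inter_iff, mem_ofPred_eq, mem_empty_iff_false, iff_false, not_and, not_le]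
    exact hl x)
  have h2 := key {x | l x = c} (fun i => (hK i).inter_eq l c) (by
    ext x
    simp only [mem_inter_iff, mem_ofPred_eq, mem_empty_iff_false, iff_false, not_and]
    exact fun hx => (hl x hx).ne)
  have h3 : ∑ i ∈ s, α i * μ (K i ∩ {x | l x ≤ c}) + ∑ i ∈ s, α i * μ (K i ∩ {x | c ≤ l x}) =
      ∑ i ∈ s, α i * μ (K i) + ∑ i ∈ s, α i * μ (K i ∩ {x | l x = c}) := by
    rw [← Finset.sum_add_distrib, ← Finset.sum_add_distrib]
    exact Finset.sum_congr rfl fun i _ => by rw [← mul_add, hμ.split _ (hK i), mul_add]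
  linarith

/-- **Groemer's theorem**: linear relations between indicator functions of compact convex sets
are respected by convex contents. -/
theorem IsConvexContent.sum_eq_zero [SecondCountableTopology E] (hμ : IsConvexContent μ)
    {ι : Type*} (α : ι → ℝ) (s : Finset ι) (K : ι → Set E)
    (hK : ∀ i, CompactConvex (K i)) (h0 : ∀ x, ∑ i ∈ s, α i * (K i).indicator 1 x = 0) :
    ∑ i ∈ s, α i * μ (K i) = 0 := by
  classical
  induction s using Finset.strongInduction generalizing K with
  | H s ih =>
  -- Cutting successively by the half-spaces whose intersection is `K j` leaves the sum unchanged;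
  -- continuity along decreasing sequences gives the limit.
  have step1 : ∀ j ∈ s, ∀ K : ι → Set E, (∀ i, CompactConvex (K i)) →
      (∀ x, ∑ i ∈ s, α i * (K i).indicator 1 x = 0) →
      ∑ i ∈ s, α i * μ (K i) = ∑ i ∈ s, α i * μ (K i ∩ K j) := by
    intro j hj K hK h0
    obtain ⟨l, c, hl, hlK⟩ := exists_seq_halfSpace (hK j)
    have hfin : ∀ k : ℕ, ∑ i ∈ s, α i * μ (K i) =
        ∑ i ∈ s, α i * μ (K i ∩ ⋂ (m) (_ : m < k), {x | l m x ≤ c m}) := by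
      intro k
      induction k with
      | zero => simp
      | succ k ihk =>
        rw [ihk, hμ.sum_eq_sum_inter_le s α hj
          (fun L hL h => ih _ (Finset.erase_ssubset hj) L hL h) _
          (fun i => (hK i).inter_iInter_le (fun m => m < k) l c)
          (sum_mul_indicator_inter h0 _) (l k) (c k) (fun x hx => hl k x hx.1)]
        refine Finset.sum_congr rfl fun i _ => ?_
        rw [inter_assoc, biInter_lt_succ]
    have hlim : Tendsto (fun k : ℕ => ∑ i ∈ s, α i *
        μ (K i ∩ ⋂ (m) (_ : m < k), {x | l m x ≤ c m})) atTop
        (𝓝 (∑ i ∈ s, α i * μ (K i ∩ K j))) := by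
      refine tendsto_finsetSum _ fun i _ => Tendsto.const_mul _ ?_
      have := hμ.tendsto_iInter (fun k : ℕ => K i ∩ ⋂ (m) (_ : m < k), {x | l m x ≤ c m})
        (fun k => (hK i).inter_iInter_le (fun m => m < k) l c)
        (fun a b hab => inter_subset_inter_right _
          (biInter_subset_biInter_left fun m (hm : m < a) => hm.trans_le hab))
      convert this using 3
      rw [← inter_iInter, ← hlK]
      congr 1
      ext x
      simp only [mem_iInter]
      exact ⟨fun h _ m _ => h m, fun h m => h (m + 1) m (Nat.lt_succ_self m)⟩
    exact tendsto_nhds_unique (tendsto_const_nhds.congr hfin) hlim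
  -- Applying this for every `j` in turn replaces each set by the same common intersection, so the
  -- sum becomes a multiple of a single value.
  have step2 : ∀ t : Finset ι, t ⊆ s →
      ∑ i ∈ s, α i * μ (K i) = ∑ i ∈ s, α i * μ (K i ∩ ⋂ j ∈ t, K j) := by
    intro t
    induction t using Finset.induction_on with
    | empty => simp
    | insert j t hjt iht =>
      intro hts
      rw [iht ((Finset.subset_insert j t).trans hts),
        step1 j (hts (Finset.mem_insert_self j t)) (fun i => K i ∩ ⋂ j ∈ t, K j)
          (fun i => (hK i).inter_biInter t fun j _ => hK j) (sum_mul_indicator_inter h0 _)]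
      refine Finset.sum_congr rfl fun i _ => ?_
      congr 2
      rw [Finset.set_biInter_insert]
      ext x
      simp only [mem_inter_iff]
      tauto
  rw [step2 s subset_rfl]
  have h3 : ∀ i ∈ s, α i * μ (K i ∩ ⋂ j ∈ s, K j) = α i * μ (⋂ j ∈ s, K j) := fun i hi => by
    rw [inter_eq_right.2 (show ⋂ j ∈ s, K j ⊆ K i from iInter₂_subset i hi)]
  rw [Finset.sum_congr rfl h3, ← Finset.sum_mul]
  -- At a common point the relation says that the coefficients add up to zero.
  rcases (⋂ j ∈ s, K j).eq_empty_or_nonempty with he | ⟨x, hx⟩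
  · rw [he, hμ.empty, mul_zero]
  · have := h0 x
    have h4 : ∀ i ∈ s, α i * (K i).indicator 1 x = α i := fun i hi => by
      rw [indicator_of_mem (mem_iInter₂.1 hx i hi), Pi.one_apply, mul_one]
    rw [Finset.sum_congr rfl h4] at this
    rw [this, zero_mul]

/-- A convex content is the restriction of a linear functional ("integral") on functions. -/
theorem IsConvexContent.exists_dual [SecondCountableTopology E] (hμ : IsConvexContent μ) :
    ∃ Λ : Module.Dual ℝ (E → ℝ), ∀ K, CompactConvex K → Λ (K.indicator 1) = μ K := by
  let L : ({K : Set E // CompactConvex K} →₀ ℝ) →ₗ[ℝ] (E → ℝ) :=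
    Finsupp.linearCombination ℝ fun K => (K : Set E).indicator 1
  let Φ : Module.Dual ℝ ({K : Set E // CompactConvex K} →₀ ℝ) :=
    Finsupp.linearCombination ℝ fun K => μ (K : Set E)
  -- Groemer's theorem says that `Φ` vanishes on the kernel of `L`; over a field it therefore
  -- factors as `Λ ∘ L` with `Λ` defined on all functions.
  have hΦ : Φ ∈ (LinearMap.ker L).dualAnnihilator := by
    rw [Submodule.mem_dualAnnihilator]
    intro w hw
    have := hμ.sum_eq_zero (fun i => w i) w.support (fun K => (K : Set E)) (fun K => K.2) ?_
    · simpa [Φ, Finsupp.linearCombination_apply, Finsupp.sum] using this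
    · intro x
      have := congrFun (LinearMap.mem_ker.1 hw) x
      simpa [L, Finsupp.linearCombination_apply, Finsupp.sum] using this
  rw [← LinearMap.range_dualMap_eq_dualAnnihilator_ker] at hΦ
  obtain ⟨Λ, hΛ⟩ := hΦ
  refine ⟨Λ, fun K hK => ?_⟩
  have := LinearMap.congr_fun hΛ (Finsupp.single ⟨K, hK⟩ 1)
  simpa [L, Φ] using this

end Groemer

/-! ### The additive extension to the convex ring. -/

section Extension

/-- In the Vietoris topology, compactness pushes the decreasing sets into any open set around the
limit, and each of them hits whatever the smaller limit hits. -/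
theorem TopologicalSpace.NonemptyCompacts.tendsto_of_antitone {X : Type*} [TopologicalSpace X]
    [T2Space X] {K : ℕ → NonemptyCompacts X} {L : NonemptyCompacts X}
    (hK : Antitone fun j => (K j : Set X)) (hL : (L : Set X) = ⋂ j, (K j : Set X)) :
    Tendsto K atTop (𝓝 L) := by
  rw [(NonemptyCompacts.isTopologicalBasis (α := X)).nhds_hasBasis.tendsto_right_iff]
  rintro _ ⟨⟨u, ⟨-, -, huo⟩, rfl⟩, hLu, hLu'⟩
  obtain ⟨j, hj⟩ := exists_subset_nhds_of_isCompact (V := fun j => (K j : Set X)) (U := ⋃₀ u)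
    hK.directed_ge (fun j => (K j).isCompact)
    (fun x hx => (isOpen_sUnion huo).mem_nhds (hLu (hL ▸ hx)))
  filter_upwards [eventually_ge_atTop j] with i hi
  exact ⟨(hK hi).trans hj, fun U hU => (hLu' U hU).mono
    (inter_subset_inter_left _ (hL ▸ iInter_subset _ i))⟩

variable {n : ℕ}

/-- A convex body as a nonempty compact set. -/
def ConvexBody.toNonemptyCompacts (K : ConvexBody (Euc n)) : NonemptyCompacts (Euc n) :=
  ⟨⟨K, K.isCompact⟩, K.nonempty⟩

@[simp]
theorem ConvexBody.coe_toNonemptyCompacts (K : ConvexBody (Euc n)) :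
    (K.toNonemptyCompacts : Set (Euc n)) = K := rfl

theorem ConvexBody.isometry_toNonemptyCompacts :
    Isometry (ConvexBody.toNonemptyCompacts (n := n)) := fun K L => by
  rw [← ConvexBody.hausdorffEDist_coe]
  rfl

/-- The value of `φ` at a compact convex set, and `0` at the empty set. -/
noncomputable def bodyValue (φ : ConvexBody (Euc n) → ℝ) (A : Set (Euc n)) : ℝ :=
  open Classical in
  if h : CompactConvex A ∧ A.Nonempty then φ ⟨A, h.1.2, h.1.1, h.2⟩ else 0

variable {φ : ConvexBody (Euc n) → ℝ}

theorem bodyValue_of_nonempty {A : Set (Euc n)} (hA : CompactConvex A) (h : A.Nonempty) :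
    bodyValue φ A = φ ⟨A, hA.2, hA.1, h⟩ := dif_pos ⟨hA, h⟩

@[simp]
theorem bodyValue_empty : bodyValue φ ∅ = 0 := dif_neg (by simp)

@[simp]
theorem bodyValue_coe (K : ConvexBody (Euc n)) : bodyValue φ K = φ K :=
  bodyValue_of_nonempty K.compactConvex K.nonempty

/-- If `K` meets both half-spaces, the intermediate value theorem makes the hyperplane section
nonempty, so the valuation identity concerns genuine bodies. Otherwise the identity is trivial. A
decreasing sequence with empty intersection is eventually empty, by compactness. -/
theorem IsVal.isConvexContent (hφ : IsVal φ) : IsConvexContent (bodyValue φ) where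
  empty := bodyValue_empty
  split K hK l c := by
    have hge : ¬ (K ∩ {x | l x ≤ c}).Nonempty → ∀ x ∈ K, c < l x := fun h x hx => by
      by_contra! hc
      exact h ⟨x, hx, hc⟩
    have hle : ¬ (K ∩ {x | c ≤ l x}).Nonempty → ∀ x ∈ K, l x < c := fun h x hx => by
      by_contra! hc
      exact h ⟨x, hx, hc⟩
    by_cases h1 : (K ∩ {x | l x ≤ c}).Nonempty
    · by_cases h2 : (K ∩ {x | c ≤ l x}).Nonempty
      · obtain ⟨x, hxK, hx⟩ := h1
        obtain ⟨y, hyK, hy⟩ := h2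
        obtain ⟨z, hzK, hz⟩ := hK.2.isPreconnected.intermediate_value hxK hyK
          l.continuous.continuousOn ⟨hx, hy⟩
        rw [bodyValue_of_nonempty (hK.inter_le l c) ⟨x, hxK, hx⟩,
          bodyValue_of_nonempty (hK.inter_ge l c) ⟨y, hyK, hy⟩,
          bodyValue_of_nonempty (hK.inter_eq l c) ⟨z, hzK, hz⟩,
          bodyValue_of_nonempty hK ⟨z, hzK⟩]
        refine (hφ.additive _ _ _ _ ?_ ?_).symm
        · ext w
          have := le_total (l w) c
          change w ∈ K ↔ (w ∈ K ∧ l w ≤ c) ∨ (w ∈ K ∧ c ≤ l w)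
          tauto
        · ext w
          change (w ∈ K ∧ l w = c) ↔ (w ∈ K ∧ l w ≤ c) ∧ (w ∈ K ∧ c ≤ l w)
          rw [le_antisymm_iff]
          tauto
      · have e1 : K ∩ {x | l x ≤ c} = K := inter_eq_left.2 fun x hx => (hle h2 x hx).le
        have e2 : K ∩ {x | l x = c} = ∅ := by
          rw [← disjoint_iff_inter_eq_empty, disjoint_left]
          exact fun x hx => (hle h2 x hx).ne
        rw [not_nonempty_iff_eq_empty.1 h2, e1, e2]
    · have e1 : K ∩ {x | c ≤ l x} = K := inter_eq_left.2 fun x hx => (hge h1 x hx).le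
      have e2 : K ∩ {x | l x = c} = ∅ := by
        rw [← disjoint_iff_inter_eq_empty, disjoint_left]
        exact fun x hx => (hge h1 x hx).ne'
      rw [not_nonempty_iff_eq_empty.1 h1, e1, e2, add_comm]
  tendsto_iInter K hK hanti := by
    have hcc : CompactConvex (⋂ j, K j) :=
      ⟨(hK 0).1.of_isClosed_subset (isClosed_iInter fun j => (hK j).1.isClosed) (iInter_subset _ 0),
        convex_iInter fun j => (hK j).2⟩
    by_cases h : (⋂ j, K j).Nonempty
    · have hj : ∀ j, (K j).Nonempty := fun j => h.mono (iInter_subset _ j)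
      simp_rw [fun j => bodyValue_of_nonempty (φ := φ) (hK j) (hj j),
        bodyValue_of_nonempty (φ := φ) hcc h]
      refine (hφ.continuous.tendsto _).comp ?_
      rw [ConvexBody.isometry_toNonemptyCompacts.isEmbedding.tendsto_nhds_iff]
      exact NonemptyCompacts.tendsto_of_antitone hanti rfl
    · have : ∃ j, ¬ (K j).Nonempty := by
        by_contra! hne
        exact h (IsCompact.nonempty_iInter_of_directed_nonempty_isCompact_isClosed K
          hanti.directed_ge hne (fun j => (hK j).1) fun j => (hK j).1.isClosed)
      obtain ⟨j, hj⟩ := this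
      rw [not_nonempty_iff_eq_empty.1 h, bodyValue_empty]
      refine tendsto_const_nhds.congr' ?_
      filter_upwards [eventually_ge_atTop j] with i hi
      have hi' : K i = ∅ := subset_empty_iff.1 (by
        rw [← not_nonempty_iff_eq_empty.1 hj]
        exact hanti hi)
      rw [hi', bodyValue_empty]

/-- `Λ` is a linear functional whose value at the indicator function of a convex body `K`
is `φ K`. -/
def Represents (Λ : Module.Dual ℝ (Euc n → ℝ)) (φ : ConvexBody (Euc n) → ℝ) : Prop :=
  ∀ K, CompactConvex K → Λ (K.indicator 1) = bodyValue φ K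

theorem IsVal.exists_represents (hφ : IsVal φ) :
    ∃ Λ : Module.Dual ℝ (Euc n → ℝ), Represents Λ φ := hφ.isConvexContent.exists_dual

variable {Λ : Module.Dual ℝ (Euc n → ℝ)}

theorem Represents.isAdditiveExtension (hΛ : Represents Λ φ) :
    IsAdditiveExtension φ fun A => Λ (A.indicator 1) where
  empty := by
    rw [hΛ _ CompactConvex.empty, bodyValue_empty]
  extends_body K := by rw [hΛ _ K.compactConvex, bodyValue_coe]
  additive A _ B _ := by
    rw [← map_add, ← map_add]
    congr 1
    ext x
    by_cases hA : x ∈ A <;> by_cases hB : x ∈ B <;> simp [indicator, hA, hB]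

/-- Inclusion-exclusion for a linear functional on indicator functions. -/
theorem dual_indicator_biUnion {X ι : Type*} (Λ : Module.Dual ℝ (X → ℝ)) (s : Finset ι)
    (S : ι → Set X) :
    Λ ((⋃ i ∈ s, S i).indicator 1) = ∑ t ∈ s.powerset with t.Nonempty,
      (-1 : ℝ) ^ (t.card + 1) * Λ ((⋂ i ∈ t, S i).indicator 1) := by
  have : (⋃ i ∈ s, S i).indicator (1 : X → ℝ) = ∑ t ∈ s.powerset with t.Nonempty,
      (-1 : ℝ) ^ (t.card + 1) • (⋂ i ∈ t, S i).indicator (1 : X → ℝ) := by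
    ext x
    rw [Finset.indicator_biUnion_eq_sum_powerset]
    simp [Finset.sum_apply, zsmul_eq_mul]
  rw [this, map_sum]
  simp

theorem abs_dual_indicator_biUnion_le {X ι : Type*} (Λ : Module.Dual ℝ (X → ℝ)) (s : Finset ι)
    (S : ι → Set X) :
    |Λ ((⋃ i ∈ s, S i).indicator 1)| ≤ ∑ t ∈ s.powerset with t.Nonempty,
      |Λ ((⋂ i ∈ t, S i).indicator 1)| := by
  rw [dual_indicator_biUnion]
  refine (Finset.abs_sum_le_sum_abs _ _).trans (le_of_eq ?_)
  exact Finset.sum_congr rfl fun t _ => by simp [abs_mul]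

/-- A union of compact convex sets is the union of at most as many convex bodies. -/
theorem exists_isUnionOfBodies_biUnion {ι : Type*} (s : Finset ι) {S : ι → Set (Euc n)}
    (hS : ∀ i ∈ s, CompactConvex (S i)) :
    ∃ k ≤ s.card, IsUnionOfBodies (⋃ i ∈ s, S i) k := by
  classical
  let s' := s.filter fun i => (S i).Nonempty
  refine ⟨s'.card, Finset.card_filter_le _ _, fun j =>
    ⟨S (s'.equivFin.symm j), ?_, ?_, ?_⟩, ?_⟩
  · exact (hS _ (Finset.mem_filter.1 (s'.equivFin.symm j).2).1).2
  · exact (hS _ (Finset.mem_filter.1 (s'.equivFin.symm j).2).1).1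
  · exact (Finset.mem_filter.1 (s'.equivFin.symm j).2).2
  · ext x
    simp only [ConvexBody.coe_mk, mem_iUnion, exists_prop]
    constructor
    · rintro ⟨i, hi, hx⟩
      refine ⟨s'.equivFin ⟨i, Finset.mem_filter.2 ⟨hi, x, hx⟩⟩, ?_⟩
      simpa using hx
    · rintro ⟨j, hx⟩
      exact ⟨_, (Finset.mem_filter.1 (s'.equivFin.symm j).2).1, hx⟩

theorem biUnion_mem_convexRing {ι : Type*} (s : Finset ι) {S : ι → Set (Euc n)}
    (hS : ∀ i ∈ s, CompactConvex (S i)) : (⋃ i ∈ s, S i) ∈ convexRing n := by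
  obtain ⟨k, -, hk⟩ := exists_isUnionOfBodies_biUnion s hS
  exact ⟨k, hk⟩

theorem CompactConvex.mem_convexRing {A : Set (Euc n)} (hA : CompactConvex A) :
    A ∈ convexRing n := by
  have := biUnion_mem_convexRing ({()} : Finset Unit) (S := fun _ => A) fun _ _ => hA
  rwa [Finset.set_biUnion_singleton] at this

/-- A set in the convex ring is a union of `minBodies` convex bodies. -/
theorem exists_eq_iUnion_of_mem_convexRing {A : Set (Euc n)} (hA : A ∈ convexRing n) :
    ∃ K : Fin (minBodies A) → ConvexBody (Euc n), A = ⋃ i, (K i : Set (Euc n)) :=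
  Nat.sInf_mem (s := {k | IsUnionOfBodies A k}) hA

theorem inter_mem_convexRing {A W : Set (Euc n)} (hA : A ∈ convexRing n) (hW : CompactConvex W) :
    A ∩ W ∈ convexRing n := by
  obtain ⟨k, K, rfl⟩ := hA
  have := biUnion_mem_convexRing Finset.univ (S := fun i => (K i : Set (Euc n)) ∩ W)
    fun i _ => (K i).compactConvex.inter hW
  simpa [iUnion_inter] using this

theorem union_mem_convexRing {A B : Set (Euc n)} (hA : A ∈ convexRing n) (hB : B ∈ convexRing n) :
    A ∪ B ∈ convexRing n := by
  obtain ⟨k, K, rfl⟩ := hA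
  obtain ⟨m, M, rfl⟩ := hB
  have := biUnion_mem_convexRing (Finset.univ : Finset (Fin k ⊕ Fin m))
    (S := fun i => Sum.elim (fun i => (K i : Set (Euc n))) (fun i => (M i : Set (Euc n))) i) (by
      rintro (i | i) _
      exacts [(K i).compactConvex, (M i).compactConvex])
  simpa [iUnion_sum] using this

theorem empty_mem_convexRing : (∅ : Set (Euc n)) ∈ convexRing n := CompactConvex.empty.mem_convexRing

theorem biUnion_mem_convexRing_of_mem {ι : Type*} (s : Finset ι) {S : ι → Set (Euc n)}
    (hS : ∀ i ∈ s, S i ∈ convexRing n) : (⋃ i ∈ s, S i) ∈ convexRing n := by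
  classical
  induction s using Finset.induction_on with
  | empty => simpa using empty_mem_convexRing
  | insert a s _ ih =>
    rw [Finset.set_biUnion_insert]
    exact union_mem_convexRing (hS a (Finset.mem_insert_self a s))
      (ih fun i hi => hS i (Finset.mem_insert_of_mem hi))

theorem IsAdditiveExtension.eq_bodyValue {ψ : Set (Euc n) → ℝ} (h : IsAdditiveExtension φ ψ)
    {A : Set (Euc n)} (hA : CompactConvex A) : ψ A = bodyValue φ A := by
  rcases A.eq_empty_or_nonempty with rfl | hne
  · rw [h.empty, bodyValue_empty]
  · rw [bodyValue_of_nonempty hA hne, ← h.extends_body]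
    rfl

/-- The additive extension to the convex ring is unique. -/
theorem IsAdditiveExtension.unique {ψ₁ ψ₂ : Set (Euc n) → ℝ} (h₁ : IsAdditiveExtension φ ψ₁)
    (h₂ : IsAdditiveExtension φ ψ₂) {A : Set (Euc n)} (hA : A ∈ convexRing n) : ψ₁ A = ψ₂ A := by
  classical
  -- The induction runs over compact convex sets, since intersecting with `S a` may produce empty
  -- sets, which are not bodies.
  have key : ∀ {k : ℕ} (s : Finset (Fin k)) (S : Fin k → Set (Euc n)),
      (∀ i, CompactConvex (S i)) → ψ₁ (⋃ i ∈ s, S i) = ψ₂ (⋃ i ∈ s, S i) := by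
    intro k s
    induction s using Finset.induction_on with
    | empty => intro S _; simp [h₁.empty, h₂.empty]
    | insert a s _ ih =>
      intro S hS
      have hB := biUnion_mem_convexRing s fun i _ => hS i
      have e1 := h₁.additive _ (hS a).mem_convexRing _ hB
      have e2 := h₂.additive _ (hS a).mem_convexRing _ hB
      have e3 := ih _ fun i => (hS a).inter (hS i)
      rw [← inter_iUnion₂] at e3
      rw [Finset.set_biUnion_insert]
      have e4 := h₁.eq_bodyValue (hS a)
      have e5 := h₂.eq_bodyValue (hS a)
      have e6 := ih S hS
      linarith
  obtain ⟨k, K, rfl⟩ := hA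
  simpa using key Finset.univ (fun i => (K i : Set (Euc n))) fun i => (K i).compactConvex

theorem IsVal.isAdditiveExtension (hφ : IsVal φ) : IsAdditiveExtension φ (convexRingExt φ) := by
  obtain ⟨Λ, hΛ⟩ := hφ.exists_represents
  have h : ∃ ψ : Set (Euc n) → ℝ, IsAdditiveExtension φ ψ := ⟨_, hΛ.isAdditiveExtension⟩
  rw [convexRingExt, dif_pos h]
  exact h.choose_spec

theorem Represents.convexRingExt_eq (hΛ : Represents Λ φ) (hφ : IsVal φ) {A : Set (Euc n)}
    (hA : A ∈ convexRing n) : convexRingExt φ A = Λ (A.indicator 1) :=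
  hφ.isAdditiveExtension.unique hΛ.isAdditiveExtension hA

theorem CompactConvex.image_add_right {A : Set (Euc n)} (hA : CompactConvex A) (t : Euc n) :
    CompactConvex ((fun x => x + t) '' A) :=
  ⟨hA.1.image (continuous_add_const t), by simpa only [add_comm] using hA.2.translate t⟩

theorem image_add_mem_convexRing {A : Set (Euc n)} (hA : A ∈ convexRing n) (t : Euc n) :
    (fun x => x + t) '' A ∈ convexRing n := by
  obtain ⟨k, K, rfl⟩ := hA
  have := biUnion_mem_convexRing Finset.univ (S := fun i => (fun x => x + t) '' (K i : Set (Euc n)))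
    fun i _ => (K i).compactConvex.image_add_right t
  simpa only [Finset.mem_univ, iUnion_true, image_iUnion] using this

/-- The additive extension is translation invariant. -/
theorem IsVal.convexRingExt_image_add (hφ : IsVal φ) {A : Set (Euc n)} (hA : A ∈ convexRing n)
    (t : Euc n) : convexRingExt φ ((fun x => x + t) '' A) = convexRingExt φ A := by
  have h := hφ.isAdditiveExtension
  -- The translated functional is again an additive extension of `φ`, so uniqueness applies.
  refine IsAdditiveExtension.unique (φ := φ)
    (ψ₁ := fun A => convexRingExt φ ((fun x => x + t) '' A)) ⟨?_, ?_, ?_⟩ h hA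
  · simp [h.empty]
  · intro K
    let L : ConvexBody (Euc n) := ⟨(fun x => x + t) '' (K : Set (Euc n)),
      (K.compactConvex.image_add_right t).2, (K.compactConvex.image_add_right t).1,
      K.nonempty.image _⟩
    rw [← hφ.translation_invariant K L t rfl, ← h.extends_body]
    rfl
  · intro A hA B hB
    rw [image_union, image_inter (add_left_injective t)]
    exact h.additive _ (image_add_mem_convexRing hA t) _ (image_add_mem_convexRing hB t)

end Extension

/-! ### Borel measurability on spaces of compact sets and of closed sets. -/

section Measurability

variable {n : ℕ}

/-- Nonempty compact sets carry the Borel σ-algebra of the Hausdorff metric. -/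
noncomputable instance nonemptyCompactsMeasurableSpace : MeasurableSpace (NonemptyCompacts (Euc n)) := borel _

instance nonemptyCompactsBorelSpace : BorelSpace (NonemptyCompacts (Euc n)) := ⟨rfl⟩

/-- Convex bodies carry the Borel σ-algebra of the Hausdorff metric. -/
noncomputable instance convexBodyMeasurableSpace : MeasurableSpace (ConvexBody (Euc n)) := borel _

instance convexBodyBorelSpace : BorelSpace (ConvexBody (Euc n)) := ⟨rfl⟩

/-- Nonconvexity is an open condition: if a point of a segment between `x` and `y` lies off `K`,
separate it from `K`; sets close to `K` stay on the side of `K` but contain points near `x` and `y`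
whose combination lies on the other side. -/
theorem isClosed_setOf_convex : IsClosed {K : NonemptyCompacts (Euc n) | Convex ℝ (K : Set (Euc n))} := by
  rw [← isOpen_compl_iff, isOpen_iff_mem_nhds]
  intro K hK
  have hK' : ¬ Convex ℝ (K : Set (Euc n)) := hK
  rw [convex_iff_forall_pos] at hK'
  push Not at hK'
  obtain ⟨x, hx, y, hy, a, b, ha, hb, hab, hz⟩ := hK'
  obtain ⟨V, U, hV, hU, hKV, hzU, hVU⟩ := SeparatedNhds.of_isCompact_isCompact K.isCompact
    isCompact_singleton (disjoint_singleton_right.2 hz)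
  have hc : Continuous fun p : Euc n × Euc n => a • p.1 + b • p.2 := by fun_prop
  obtain ⟨U₁, U₂, hU₁, hx₁, hU₂, hy₂, hUU⟩ := mem_nhds_prod_iff'.1
    ((hU.preimage hc).mem_nhds (show (x, y) ∈ _ from hzU rfl))
  filter_upwards [(NonemptyCompacts.isOpen_subsets_of_isOpen hV).mem_nhds hKV,
    (NonemptyCompacts.isOpen_inter_nonempty_of_isOpen hU₁).mem_nhds ⟨x, hx, hx₁⟩,
    (NonemptyCompacts.isOpen_inter_nonempty_of_isOpen hU₂).mem_nhds ⟨y, hy, hy₂⟩]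
  rintro L hLV ⟨p, hpL, hp⟩ ⟨q, hqL, hq⟩ hL
  have hL' : Convex ℝ (L : Set (Euc n)) := hL
  exact disjoint_left.1 hVU (hLV (hL' hpL hqL ha.le hb.le hab)) (hUU (mk_mem_prod hp hq))

theorem ConvexBody.isClosedEmbedding_toNonemptyCompacts :
    IsClosedEmbedding (ConvexBody.toNonemptyCompacts (n := n)) where
  __ := ConvexBody.isometry_toNonemptyCompacts.isEmbedding
  isClosed_range := by
    convert isClosed_setOf_convex (n := n)
    ext K
    constructor
    · rintro ⟨K, rfl⟩
      exact K.convex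
    · exact fun hK => ⟨⟨K, hK, K.isCompact, K.nonempty⟩, rfl⟩

instance convexBodySecondCountable : SecondCountableTopology (ConvexBody (Euc n)) :=
  ConvexBody.isClosedEmbedding_toNonemptyCompacts.isEmbedding.secondCountableTopology

instance convexBodyPolishSpace : PolishSpace (ConvexBody (Euc n)) :=
  ConvexBody.isClosedEmbedding_toNonemptyCompacts.polishSpace

/-- A set-valued map is hit-measurable if hitting any given compact set is a measurable event. -/
def HitMeasurable {Ω : Type*} [MeasurableSpace Ω] (h : Ω → Set (Euc n)) : Prop :=
  ∀ C, IsCompact C → MeasurableSet {ω | (h ω ∩ C).Nonempty}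

variable {Ω : Type*} [MeasurableSpace Ω] {h : Ω → Set (Euc n)}

theorem HitMeasurable.of_isClosed (hh : HitMeasurable h) {C : Set (Euc n)} (hC : IsClosed C) :
    MeasurableSet {ω | (h ω ∩ C).Nonempty} := by
  have : {ω | (h ω ∩ C).Nonempty} =
      ⋃ m : ℕ, {ω | (h ω ∩ (C ∩ Metric.closedBall 0 m)).Nonempty} := by
    ext ω
    simp only [mem_iUnion, mem_ofPred_eq]
    constructor
    · rintro ⟨x, hx, hxC⟩
      obtain ⟨m, hm⟩ := exists_nat_ge ‖x‖
      exact ⟨m, x, hx, hxC, by simpa using hm⟩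
    · rintro ⟨m, x, hx, hxC, -⟩
      exact ⟨x, hx, hxC⟩
  rw [this]
  exact .iUnion fun m => hh _ ((isCompact_closedBall _ _).inter_left hC)

theorem HitMeasurable.of_isOpen (hh : HitMeasurable h) {U : Set (Euc n)} (hU : IsOpen U) :
    MeasurableSet {ω | (h ω ∩ U).Nonempty} := by
  obtain ⟨F, hF, -, rfl, -⟩ := hU.exists_iUnion_isClosed
  have : {ω | (h ω ∩ ⋃ n, F n).Nonempty} = ⋃ m : ℕ, {ω | (h ω ∩ F m).Nonempty} := by
    ext ω
    simp only [mem_iUnion, mem_ofPred_eq, inter_iUnion, nonempty_iUnion]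
  rw [this]
  exact .iUnion fun m => hh.of_isClosed (hF m)

theorem HitMeasurable.measurableSet_nonempty (hh : HitMeasurable h) :
    MeasurableSet {ω | (h ω).Nonempty} := by
  simpa using hh.of_isClosed isClosed_univ

/-- A basic Vietoris set is given by missing one closed set and hitting finitely many open sets. -/
theorem HitMeasurable.measurable {g : Ω → NonemptyCompacts (Euc n)}
    (hg : HitMeasurable fun ω => (g ω : Set (Euc n))) : Measurable g := by
  have hb := NonemptyCompacts.isTopologicalBasis (α := Euc n)
  rw [nonemptyCompactsMeasurableSpace, hb.borel_eq_generateFrom]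
  refine measurable_generateFrom ?_
  rintro _ ⟨u, ⟨hu, -, huo⟩, rfl⟩
  have : g ⁻¹' {K | (K : Set (Euc n)) ⊆ ⋃₀ u ∧ ∀ U ∈ u, ((K : Set (Euc n)) ∩ U).Nonempty} =
      {ω | ((g ω : Set (Euc n)) ∩ (⋃₀ u)ᶜ).Nonempty}ᶜ ∩
        ⋂ U ∈ u, {ω | ((g ω : Set (Euc n)) ∩ U).Nonempty} := by
    ext ω
    simp [inter_compl_nonempty_iff]
  rw [this]
  exact (hg.of_isClosed (isOpen_sUnion huo).isClosed_compl).compl.inter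
    (.biInter hu.countable fun U hU => hg.of_isOpen (huo U hU))

/-- Replace the empty set by `{0}`. -/
def orZero (A : Set (Euc n)) : Set (Euc n) := A ∪ {x | x = 0 ∧ A = ∅}

theorem orZero_of_nonempty {A : Set (Euc n)} (hA : A.Nonempty) : orZero A = A := by
  simp [orZero, hA.ne_empty]

theorem orZero_empty : orZero (∅ : Set (Euc n)) = {0} := by
  simp [orZero]

theorem orZero_nonempty (A : Set (Euc n)) : (orZero A).Nonempty := by
  rcases A.eq_empty_or_nonempty with rfl | hA
  · simp [orZero_empty]
  · rwa [orZero_of_nonempty hA]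

theorem IsCompact.orZero {A : Set (Euc n)} (hA : IsCompact A) : IsCompact (orZero A) := by
  rcases A.eq_empty_or_nonempty with rfl | hA'
  · simp [orZero_empty]
  · rwa [orZero_of_nonempty hA']

theorem Convex.orZero {A : Set (Euc n)} (hA : Convex ℝ A) : Convex ℝ (orZero A) := by
  rcases A.eq_empty_or_nonempty with rfl | hA'
  · simp [orZero_empty]
  · rwa [orZero_of_nonempty hA']

theorem HitMeasurable.orZero (hh : HitMeasurable h) : HitMeasurable fun ω => orZero (h ω) := by
  intro C hC
  have : {ω | (_root_.orZero (h ω) ∩ C).Nonempty} =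
      {ω | (h ω ∩ C).Nonempty} ∪ ({ω | (h ω).Nonempty}ᶜ ∩ {_ω | (0 : Euc n) ∈ C}) := by
    ext ω
    rcases (h ω).eq_empty_or_nonempty with hA | hA
    · simp [hA, orZero_empty]
    · simp [hA, orZero_of_nonempty]
  rw [this]
  exact (hh C hC).union (hh.measurableSet_nonempty.compl.inter (.const _))

/-- A function of nonempty compact sets that is measurable can be composed with hit-measurable
compact-valued maps. -/
theorem HitMeasurable.measurable_comp (hh : HitMeasurable h) (hc : ∀ ω, IsCompact (h ω))
    {β : Type*} [MeasurableSpace β] {G : Set (Euc n) → β}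
    (hG : Measurable fun K : NonemptyCompacts (Euc n) => G K) : Measurable fun ω => G (h ω) := by
  classical
  -- The empty set is no point of the hyperspace, so it is replaced by `{0}` and treated as a
  -- separate measurable case.
  let g : Ω → NonemptyCompacts (Euc n) := fun ω => ⟨⟨_, (hc ω).orZero⟩, orZero_nonempty _⟩
  have hg : Measurable g := HitMeasurable.measurable hh.orZero
  have : (fun ω => G (h ω)) = fun ω => if (h ω).Nonempty then G (g ω) else G ∅ := by
    ext ω
    split_ifs with hne
    · congr 1
      exact (orZero_of_nonempty hne).symm
    · rw [not_nonempty_iff_eq_empty.1 hne]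
  rw [this]
  exact .ite hh.measurableSet_nonempty (hG.comp hg) measurable_const

theorem HitMeasurable.measurable_bodyValue {φ : ConvexBody (Euc n) → ℝ} (hφ : IsVal φ)
    (hh : HitMeasurable h) (hc : ∀ ω, CompactConvex (h ω)) :
    Measurable fun ω => bodyValue φ (h ω) := by
  classical
  let g : Ω → ConvexBody (Euc n) := fun ω =>
    ⟨_, (hc ω).2.orZero, (hc ω).1.orZero, orZero_nonempty _⟩
  have hg : Measurable g := by
    rw [← ConvexBody.isClosedEmbedding_toNonemptyCompacts.measurableEmbedding.measurable_comp_iff]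
    exact HitMeasurable.measurable hh.orZero
  have : (fun ω => bodyValue φ (h ω)) = fun ω => if (h ω).Nonempty then φ (g ω) else 0 := by
    ext ω
    split_ifs with hne
    · rw [bodyValue_of_nonempty (hc ω) hne]
      congr 1
      exact ConvexBody.ext (orZero_of_nonempty hne).symm
    · rw [not_nonempty_iff_eq_empty.1 hne, bodyValue_empty]
  rw [this]
  exact .ite hh.measurableSet_nonempty (hφ.continuous.measurable.comp hg) measurable_const

theorem isClosed_setOf_mem :
    IsClosed {q : Euc n × NonemptyCompacts (Euc n) | q.1 ∈ (q.2 : Set (Euc n))} := by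
  have : {q : Euc n × NonemptyCompacts (Euc n) | q.1 ∈ (q.2 : Set (Euc n))} =
      {q | Metric.infDist q.1 (q.2 : Set (Euc n)) = 0} := by
    ext q
    exact q.2.isCompact.isClosed.mem_iff_infDist_zero q.2.nonempty
  rw [this]
  exact isClosed_eq Metric.lipschitz_infDist.continuous continuous_const

/-- The event is the projection, along the compact set `C`, of a closed incidence relation, hence
closed. Intersection itself is not continuous in the bodies. -/
theorem hitMeasurable_biInter {k : ℕ} (t : Finset (Fin k)) :
    HitMeasurable fun K : Fin k → ConvexBody (Euc n) => ⋂ i ∈ t, (K i : Set (Euc n)) := by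
  intro C hC
  have : CompactSpace C := isCompact_iff_compactSpace.1 hC
  have hcl : IsClosed {p : C × (Fin k → ConvexBody (Euc n)) |
      ∀ i ∈ t, (p.1 : Euc n) ∈ (p.2 i : Set (Euc n))} := by
    simp only [ofPred_forall]
    refine isClosed_iInter fun i => isClosed_iInter fun _ => ?_
    have h2 : Continuous fun p : C × (Fin k → ConvexBody (Euc n)) =>
        ((p.1 : Euc n), (p.2 i).toNonemptyCompacts) :=
      (continuous_subtype_val.comp continuous_fst).prodMk
        (ConvexBody.isometry_toNonemptyCompacts.continuous.comp
          ((continuous_apply i).comp continuous_snd))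
    exact isClosed_setOf_mem.preimage h2
  have := isClosedMap_snd_of_compactSpace _ hcl
  convert this.measurableSet
  ext K
  simp only [mem_ofPred_eq, mem_image, Prod.exists, exists_eq_right]
  constructor
  · rintro ⟨x, hx, hxC⟩
    exact ⟨⟨x, hxC⟩, fun i hi => mem_iInter₂.1 hx i hi⟩
  · rintro ⟨x, hx⟩
    exact ⟨x, mem_iInter₂.2 hx, x.2⟩

/-- The union of `k + 1` convex bodies. -/
def unionMap (k : ℕ) (K : Fin (k + 1) → ConvexBody (Euc n)) : NonemptyCompacts (Euc n) :=
  ⟨⟨⋃ i, (K i : Set (Euc n)), isCompact_iUnion fun i => (K i).isCompact⟩,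
    (K 0).nonempty.mono (subset_iUnion (fun i => (K i : Set (Euc n))) 0)⟩

@[simp]
theorem coe_unionMap (k : ℕ) (K : Fin (k + 1) → ConvexBody (Euc n)) :
    (unionMap k K : Set (Euc n)) = ⋃ i, (K i : Set (Euc n)) := rfl

theorem continuous_unionMap (k : ℕ) : Continuous (unionMap (n := n) k) := by
  rw [(NonemptyCompacts.isTopologicalBasis (α := Euc n)).continuous_iff]
  rintro _ ⟨u, ⟨hu, -, huo⟩, rfl⟩
  have hc : ∀ i, Continuous fun K : Fin (k + 1) → ConvexBody (Euc n) =>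
      (K i).toNonemptyCompacts := fun i =>
    ConvexBody.isometry_toNonemptyCompacts.continuous.comp (continuous_apply i)
  have : unionMap k ⁻¹' {K | (K : Set (Euc n)) ⊆ ⋃₀ u ∧ ∀ U ∈ u, ((K : Set (Euc n)) ∩ U).Nonempty} =
      (⋂ i, {K : Fin (k + 1) → ConvexBody (Euc n) |
        ((K i).toNonemptyCompacts : Set (Euc n)) ⊆ ⋃₀ u}) ∩
        ⋂ U ∈ u, ⋃ i, {K : Fin (k + 1) → ConvexBody (Euc n) |
          (((K i).toNonemptyCompacts : Set (Euc n)) ∩ U).Nonempty} := by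
    ext K
    simp [iUnion_inter]
  rw [this]
  refine (isOpen_iInter_of_finite fun i => ?_).inter (hu.isOpen_biInter fun U hU =>
    isOpen_iUnion fun i => ?_)
  · exact (NonemptyCompacts.isOpen_subsets_of_isOpen (isOpen_sUnion huo)).preimage (hc i)
  · exact (NonemptyCompacts.isOpen_inter_nonempty_of_isOpen (huo U hU)).preimage (hc i)

/-- By the Blaschke selection theorem, the unions of `k + 1` convex bodies form an `F_σ` set. -/
theorem measurableSet_range_unionMap (k : ℕ) : MeasurableSet (range (unionMap (n := n) k)) := by
  let B : ℕ → Set (ConvexBody (Euc n)) := fun m => {K | (K : Set (Euc n)) ⊆ Metric.closedBall 0 m}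
  have hB : ∀ m, IsCompact (B m) := fun m =>
    ConvexBody.isClosedEmbedding_toNonemptyCompacts.isCompact_preimage
      (NonemptyCompacts.isCompact_subsets_of_isCompact (isCompact_closedBall (0 : Euc n) m))
  have : range (unionMap (n := n) k) = ⋃ m, unionMap k '' (univ.pi fun _ => B m) := by
    ext y
    simp only [mem_iUnion]
    constructor
    · rintro ⟨K, rfl⟩
      obtain ⟨r, hr⟩ := (unionMap k K).isCompact.isBounded.subset_closedBall (0 : Euc n)
      obtain ⟨m, hm⟩ := exists_nat_ge r
      refine ⟨m, K, fun i _ => ?_, rfl⟩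
      exact (subset_iUnion (fun i => (K i : Set (Euc n))) i).trans
        (hr.trans (Metric.closedBall_subset_closedBall hm))
    · rintro ⟨m, K, -, rfl⟩
      exact ⟨K, rfl⟩
  rw [this]
  exact .iUnion fun m => ((isCompact_univ_pi fun _ => hB m).image
    (continuous_unionMap k)).isClosed.measurableSet

theorem isUnionOfBodies_succ_iff {y : NonemptyCompacts (Euc n)} {k : ℕ} :
    IsUnionOfBodies (y : Set (Euc n)) (k + 1) ↔ y ∈ range (unionMap k) := by
  constructor
  · rintro ⟨K, hK⟩
    exact ⟨K, NonemptyCompacts.ext hK.symm⟩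
  · rintro ⟨K, rfl⟩
    exact ⟨K, rfl⟩

theorem not_isUnionOfBodies_zero (y : NonemptyCompacts (Euc n)) :
    ¬ IsUnionOfBodies (y : Set (Euc n)) 0 := by
  rintro ⟨K, hK⟩
  have := y.nonempty
  rw [hK] at this
  simp at this

theorem measurableSet_isUnionOfBodies (k : ℕ) :
    MeasurableSet {y : NonemptyCompacts (Euc n) | IsUnionOfBodies (y : Set (Euc n)) k} := by
  cases k with
  | zero => simp [not_isUnionOfBodies_zero]
  | succ k =>
    simp_rw [isUnionOfBodies_succ_iff]
    exact measurableSet_range_unionMap k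

theorem HitMeasurable.measurable_minBodies (hh : HitMeasurable h) (hc : ∀ ω, IsCompact (h ω)) :
    Measurable fun ω => minBodies (h ω) := by
  refine hh.measurable_comp hc (measurable_of_Iic fun m => ?_)
  -- An infimum over the empty set of naturals is `0`, so sets outside the convex ring lie in every
  -- sublevel set.
  have : (fun K : NonemptyCompacts (Euc n) => minBodies (K : Set (Euc n))) ⁻¹' Iic m =
      (⋃ k, ⋃ (_ : k ≤ m), {y : NonemptyCompacts (Euc n) | IsUnionOfBodies (y : Set (Euc n)) k}) ∪
        ⋂ k, {y : NonemptyCompacts (Euc n) | IsUnionOfBodies (y : Set (Euc n)) k}ᶜ := by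
    ext y
    simp only [mem_preimage, mem_Iic, mem_union, mem_iUnion, mem_ofPred_eq, mem_iInter,
      mem_compl_iff, exists_prop]
    constructor
    · intro hm
      by_cases hy : ∃ k, IsUnionOfBodies (y : Set (Euc n)) k
      · exact Or.inl ⟨_, hm, exists_eq_iUnion_of_mem_convexRing hy⟩
      · exact Or.inr (not_exists.1 hy)
    · rintro (⟨k, hk, hy⟩ | hy)
      · exact (Nat.sInf_le hy).trans hk
      · have : {k | IsUnionOfBodies (y : Set (Euc n)) k} = ∅ := by
          ext k
          simpa using hy k
        rw [minBodies, this]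
        simp
  rw [this]
  exact (MeasurableSet.iUnion fun k => .iUnion fun _ => measurableSet_isUnionOfBodies k).union
    (.iInter fun k => (measurableSet_isUnionOfBodies k).compl)

open Classical in
/-- The additive extension of `φ`, set to `0` outside of the convex ring. -/
noncomputable def ringValue (φ : ConvexBody (Euc n) → ℝ) (A : Set (Euc n)) : ℝ :=
  if A ∈ convexRing n then convexRingExt φ A else 0

theorem ringValue_of_mem {φ : ConvexBody (Euc n) → ℝ} {A : Set (Euc n)} (hA : A ∈ convexRing n) :
    ringValue φ A = convexRingExt φ A := if_pos hA

theorem IsVal.measurable_convexRingExt_iUnion {φ : ConvexBody (Euc n) → ℝ} (hφ : IsVal φ) (k : ℕ) :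
    Measurable fun K : Fin k → ConvexBody (Euc n) => convexRingExt φ (⋃ i, (K i : Set (Euc n))) := by
  obtain ⟨Λ, hΛ⟩ := hφ.exists_represents
  have : (fun K : Fin k → ConvexBody (Euc n) => convexRingExt φ (⋃ i, (K i : Set (Euc n)))) =
      fun K => ∑ t ∈ (Finset.univ : Finset (Fin k)).powerset with t.Nonempty,
        (-1 : ℝ) ^ (t.card + 1) * bodyValue φ (⋂ i ∈ t, (K i : Set (Euc n))) := by
    ext K
    rw [hΛ.convexRingExt_eq hφ ⟨k, K, rfl⟩]
    have := dual_indicator_biUnion Λ Finset.univ fun i => (K i : Set (Euc n))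
    simp only [Finset.mem_univ, iUnion_true] at this
    rw [this]
    refine Finset.sum_congr rfl fun t ht => ?_
    rw [hΛ _ (CompactConvex.biInter (Finset.mem_filter.1 ht).2 fun i _ => (K i).compactConvex)]
  rw [this]
  refine Finset.measurable_sum _ fun t ht => Measurable.const_mul ?_ _
  exact (hitMeasurable_biInter t).measurable_bodyValue hφ fun K =>
    CompactConvex.biInter (Finset.mem_filter.1 ht).2 fun i _ => (K i).compactConvex

/-- No measurable choice of a decomposition into bodies is needed: for a Borel map on a Polish space
with Borel range, a subset of the range is Borel as soon as its preimage is. The preimages are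
handled by inclusion-exclusion. -/
theorem IsVal.measurable_ringValue {φ : ConvexBody (Euc n) → ℝ} (hφ : IsVal φ) :
    Measurable fun K : NonemptyCompacts (Euc n) => ringValue φ K := by
  classical
  have hmem : ∀ k, MeasurableSet (range (unionMap (n := n) k)) := measurableSet_range_unionMap
  have hring : ∀ y : NonemptyCompacts (Euc n),
      (y : Set (Euc n)) ∈ convexRing n ↔ ∃ k, y ∈ range (unionMap k) := by
    intro y
    constructor
    · rintro ⟨k, hk⟩
      cases k with
      | zero => exact absurd hk (not_isUnionOfBodies_zero y)
      | succ k => exact ⟨k, isUnionOfBodies_succ_iff.1 hk⟩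
    · rintro ⟨k, hk⟩
      exact ⟨k + 1, isUnionOfBodies_succ_iff.2 hk⟩
  intro B hB
  have : (fun K : NonemptyCompacts (Euc n) => ringValue φ K) ⁻¹' B =
      (⋃ k, {y : NonemptyCompacts (Euc n) | convexRingExt φ y ∈ B} ∩ range (unionMap k)) ∪
        ((⋃ k, range (unionMap k))ᶜ ∩ {_y | (0 : ℝ) ∈ B}) := by
    ext y
    simp only [mem_preimage, ringValue, hring, mem_union, mem_iUnion, mem_inter_iff,
      mem_compl_iff, mem_ofPred_eq]
    split_ifs with hy
    · simp only [exists_and_left, hy, and_true, not_true, false_and, or_false]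
    · simp only [exists_and_left, hy, and_false, not_false_iff, true_and, false_or]
  rw [this]
  refine (MeasurableSet.iUnion fun k => ?_).union
    ((MeasurableSet.iUnion hmem).compl.inter (.const _))
  rw [← Measurable.measurableSet_preimage_iff_inter_range (continuous_unionMap k).measurable
    (hmem k)]
  exact hφ.measurable_convexRingExt_iUnion (k + 1) hB

theorem hitMeasurable_inter {W : Set (Euc n)} (hW : IsCompact W) :
    HitMeasurable fun F : Closeds (Euc n) => (F : Set (Euc n)) ∩ W := by
  intro C hC
  have : {F : Closeds (Euc n) | ((F : Set (Euc n)) ∩ W ∩ C).Nonempty} =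
      {F : Closeds (Euc n) | (F : Set (Euc n)) ∩ (W ∩ C) = ∅}ᶜ := by
    ext F
    simp [inter_assoc, nonempty_iff_ne_empty]
  rw [this]
  have hopen : @IsOpen _ (hitOrMissTopology n)
      {F : Closeds (Euc n) | (F : Set (Euc n)) ∩ (W ∩ C) = ∅} :=
    .basic _ (Or.inl ⟨_, hW.inter hC, rfl⟩)
  exact MeasurableSet.compl (MeasurableSpace.measurableSet_generateFrom hopen)

theorem isCompact_coe_inter (F : Closeds (Euc n)) {W : Set (Euc n)} (hW : IsCompact W) :
    IsCompact ((F : Set (Euc n)) ∩ W) := hW.inter_left F.isClosed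

theorem measurable_minBodies_inter {W : Set (Euc n)} (hW : IsCompact W) :
    Measurable fun F : Closeds (Euc n) => minBodies ((F : Set (Euc n)) ∩ W) :=
  (hitMeasurable_inter hW).measurable_minBodies fun F => isCompact_coe_inter F hW

theorem IsVal.measurable_ringValue_inter {φ : ConvexBody (Euc n) → ℝ} (hφ : IsVal φ)
    {W : Set (Euc n)} (hW : IsCompact W) :
    Measurable fun F : Closeds (Euc n) => ringValue φ ((F : Set (Euc n)) ∩ W) :=
  (hitMeasurable_inter hW).measurable_comp (fun F => isCompact_coe_inter F hW)
    hφ.measurable_ringValue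

end Measurability

/-! ### Bounds for the extension by the number of bodies. -/

section Bounds

variable {n : ℕ} {φ : ConvexBody (Euc n) → ℝ} {Λ : Module.Dual ℝ (Euc n → ℝ)}

theorem image_add_closedBall (t x : Euc n) (r : ℝ) :
    (fun y => y + t) '' Metric.closedBall x r = Metric.closedBall (x + t) r := by
  ext y
  rw [image_add_right, mem_preimage, Metric.mem_closedBall, Metric.mem_closedBall, dist_eq_norm,
    dist_eq_norm]
  congr! 2
  abel

theorem IsUnionOfBodies.image_add {A : Set (Euc n)} {k : ℕ} (h : IsUnionOfBodies A k) (t : Euc n) :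
    IsUnionOfBodies ((fun x => x + t) '' A) k := by
  obtain ⟨K, rfl⟩ := h
  refine ⟨fun i => ⟨(fun x => x + t) '' (K i : Set (Euc n)),
    ((K i).compactConvex.image_add_right t).2, ((K i).compactConvex.image_add_right t).1,
    (K i).nonempty.image _⟩, ?_⟩
  rw [image_iUnion]
  rfl

theorem minBodies_image_add (A : Set (Euc n)) (t : Euc n) :
    minBodies ((fun x => x + t) '' A) = minBodies A := by
  unfold minBodies
  congr 1
  ext k
  refine ⟨fun h => ?_, fun h => h.image_add t⟩
  have h' := IsUnionOfBodies.image_add h (-t)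
  rwa [image_image, image_congr (g := id) (fun a _ => by simp), image_id] at h'

/-- The bodies in a fixed unit ball form a compact set by Blaschke selection; translation invariance
moves the bound to every centre. -/
theorem IsVal.exists_bound (hφ : IsVal φ) : ∃ c, 0 ≤ c ∧ ∀ (K : Set (Euc n)) (t : Euc n),
    CompactConvex K → K ⊆ Metric.closedBall t 1 → |bodyValue φ K| ≤ c := by
  have hB : IsCompact {K : ConvexBody (Euc n) | (K : Set (Euc n)) ⊆ Metric.closedBall 0 1} :=
    ConvexBody.isClosedEmbedding_toNonemptyCompacts.isCompact_preimage
      (NonemptyCompacts.isCompact_subsets_of_isCompact (isCompact_closedBall (0 : Euc n) 1))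
  obtain ⟨c, hc⟩ := hB.exists_bound_of_continuousOn hφ.continuous.continuousOn
  refine ⟨max c 0, le_max_right _ _, fun K t hK hKt => ?_⟩
  rcases K.eq_empty_or_nonempty with rfl | hne
  · simp
  let L : ConvexBody (Euc n) := ⟨(fun x => x + -t) '' K, (hK.image_add_right _).2,
    (hK.image_add_right _).1, hne.image _⟩
  rw [bodyValue_of_nonempty hK hne, ← hφ.translation_invariant _ L (-t) rfl]
  refine (hc L ?_).trans (le_max_left _ _)
  have := image_mono (f := fun x => x + -t) hKt
  rwa [image_add_closedBall, add_neg_cancel] at this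

theorem mem_extendedConvexRing_inter {F W : Set (Euc n)} (hF : F ∈ extendedConvexRing n)
    (hW : CompactConvex W) : F ∩ W ∈ convexRing n := by
  obtain ⟨r, hr0, hr⟩ := hW.1.isBounded.subset_closedBall_lt 0 (0 : Euc n)
  have := inter_mem_convexRing (hF r hr0) hW
  rwa [inter_assoc, inter_eq_right.2 hr] at this

/-- A bound for the additive extension on sets contained in a ball. -/
theorem Represents.abs_le_of_subset_closedBall (hΛ : Represents Λ φ) {c : ℝ}
    (hc : ∀ (K : Set (Euc n)) (t : Euc n),
      CompactConvex K → K ⊆ Metric.closedBall t 1 → |bodyValue φ K| ≤ c)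
    {A W : Set (Euc n)} {t : Euc n} (hA : A ∈ convexRing n) (hW : CompactConvex W)
    (hWt : W ⊆ Metric.closedBall t 1) :
    |Λ ((A ∩ W).indicator 1)| ≤ c * 2 ^ minBodies A := by
  have hc0 : 0 ≤ c := (abs_nonneg _).trans (hc ∅ 0 CompactConvex.empty (empty_subset _))
  obtain ⟨K, hK⟩ := exists_eq_iUnion_of_mem_convexRing hA
  have hAW : A ∩ W = ⋃ i ∈ (Finset.univ : Finset (Fin (minBodies A))), (K i : Set (Euc n)) ∩ W := by
    conv_lhs => rw [hK, iUnion_inter]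
    simp
  rw [hAW]
  refine (abs_dual_indicator_biUnion_le Λ _ _).trans ((Finset.sum_le_card_nsmul _ _ c ?_).trans ?_)
  · intro u hu
    have hu' := (Finset.mem_filter.1 hu).2
    have hcc : CompactConvex (⋂ i ∈ u, (K i : Set (Euc n)) ∩ W) :=
      CompactConvex.biInter hu' fun i _ => (K i).compactConvex.inter hW
    rw [hΛ _ hcc]
    obtain ⟨j, hj⟩ := hu'
    refine hc _ t hcc (subset_trans (iInter₂_subset j hj) (inter_subset_right.trans hWt))
  · rw [nsmul_eq_mul, mul_comm]
    gcongr
    refine (Nat.cast_le.2 (Finset.card_filter_le _ _)).trans ?_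
    simp

/-- A bound for the additive extension on sets covered by finitely many unit balls. -/
theorem Represents.abs_le_of_subset_biUnion (hΛ : Represents Λ φ) {c : ℝ}
    (hc : ∀ (K : Set (Euc n)) (t : Euc n),
      CompactConvex K → K ⊆ Metric.closedBall t 1 → |bodyValue φ K| ≤ c)
    {F W : Set (Euc n)} (hF : F ∈ extendedConvexRing n) (hW : CompactConvex W)
    (s : Finset (Euc n)) (hWs : W ⊆ ⋃ t ∈ s, Metric.closedBall t 1) :
    |Λ ((F ∩ W).indicator 1)| ≤
      2 ^ s.card * c * ∑ t ∈ s, 2 ^ minBodies (F ∩ Metric.closedBall t 1) := by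
  have hc0 : 0 ≤ c := (abs_nonneg _).trans (hc ∅ 0 CompactConvex.empty (empty_subset _))
  have hball : ∀ t : Euc n, CompactConvex (Metric.closedBall t 1) := fun t =>
    ⟨isCompact_closedBall _ _, convex_closedBall _ _⟩
  have hFW : F ∩ W = ⋃ t ∈ s, (F ∩ W) ∩ Metric.closedBall t 1 := by
    rw [← inter_iUnion₂, eq_comm, inter_eq_left]
    exact inter_subset_right.trans hWs
  rw [hFW]
  refine (abs_dual_indicator_biUnion_le Λ _ _).trans ((Finset.sum_le_card_nsmul _ _
    (c * ∑ t ∈ s, 2 ^ minBodies (F ∩ Metric.closedBall t 1)) ?_).trans ?_)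
  · intro u hu
    obtain ⟨hus, hu'⟩ := Finset.mem_filter.1 hu
    have hcc : CompactConvex (⋂ t ∈ u, W ∩ Metric.closedBall t 1) :=
      CompactConvex.biInter hu' fun t _ => hW.inter (hball t)
    obtain ⟨j, hj⟩ := hu'
    -- One ball of `u` suffices to control the number of bodies; the others only cut the window
    -- further.
    have e : ⋂ t ∈ u, (F ∩ W) ∩ Metric.closedBall t 1 =
        (F ∩ Metric.closedBall j 1) ∩ ⋂ t ∈ u, W ∩ Metric.closedBall t 1 := by
      ext x
      simp only [mem_iInter, mem_inter_iff]
      constructor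
      · exact fun h => ⟨⟨(h j hj).1.1, (h j hj).2⟩, fun t ht => ⟨(h t ht).1.2, (h t ht).2⟩⟩
      · exact fun h t ht => ⟨⟨h.1.1, (h.2 t ht).1⟩, (h.2 t ht).2⟩
    rw [e]
    refine (hΛ.abs_le_of_subset_closedBall hc (mem_extendedConvexRing_inter hF (hball j)) hcc
      (subset_trans (iInter₂_subset j hj) inter_subset_right)).trans ?_
    gcongr
    exact Finset.single_le_sum (f := fun t => (2 : ℝ) ^ minBodies (F ∩ Metric.closedBall t 1))
      (fun _ _ => by positivity) (Finset.mem_powerset.1 hus hj)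
  · rw [nsmul_eq_mul, mul_assoc]
    gcongr
    refine (Nat.cast_le.2 (Finset.card_filter_le _ _)).trans ?_
    simp

end Bounds

/-! ### Integrability and stationarity. -/

section Expectation

open ProbabilityTheory

variable {n : ℕ} {Ω : Type*} [MeasurableSpace Ω]

/-- A stationary random closed set with values in the extended convex ring such that the number
of convex bodies needed in the unit ball has an exponential moment. -/
structure IsStandardRandomSet (P : Measure Ω) (Z : Ω → Closeds (Euc n)) : Prop extends
    IsStationaryRandomClosedSet P Z where
  ae_mem : ∀ᵐ ω ∂P, (Z ω : Set (Euc n)) ∈ extendedConvexRing n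
  lintegral_lt_top : ∫⁻ ω, (2 : ℝ≥0∞) ^
      minBodies ((Z ω : Set (Euc n)) ∩ Metric.closedBall (0 : Euc n) 1) ∂P < ∞

variable {P : Measure Ω} {Z : Ω → Closeds (Euc n)}

theorem IsStationaryRandomClosedSet.identDistrib [IsProbabilityMeasure P]
    (hZ : IsStationaryRandomClosedSet P Z) (t : Euc n) :
    IdentDistrib (fun ω => translateClosed t (Z ω)) Z P P where
  aemeasurable_fst := by
    -- The pushforward under a map that is not a.e. measurable is `0` by convention, which cannot be
    -- the probability law of `Z`.
    by_contra h
    have h0 := hZ.stationary t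
    rw [Measure.map_of_not_aemeasurable h] at h0
    have := Measure.isProbabilityMeasure_map (μ := P) hZ.measurable.aemeasurable
    exact IsProbabilityMeasure.ne_zero (P.map Z) h0.symm
  aemeasurable_snd := hZ.measurable.aemeasurable
  map_eq := hZ.stationary t

theorem coe_translateClosed_inter (t : Euc n) (F : Closeds (Euc n)) (W : Set (Euc n)) :
    (translateClosed t F : Set (Euc n)) ∩ (fun x => x + t) '' W =
      (fun x => x + t) '' ((F : Set (Euc n)) ∩ W) :=
  (image_inter (add_left_injective t)).symm

/-- The moment bound is the same for all unit balls. -/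
theorem IsStandardRandomSet.integrable_minBodies [IsProbabilityMeasure P]
    (hZ : IsStandardRandomSet P Z) (t : Euc n) :
    Integrable (fun ω => (2 : ℝ) ^ minBodies ((Z ω : Set (Euc n)) ∩ Metric.closedBall t 1)) P ∧
    ∫ ω, (2 : ℝ) ^ minBodies ((Z ω : Set (Euc n)) ∩ Metric.closedBall t 1) ∂P =
      ∫ ω, (2 : ℝ) ^ minBodies ((Z ω : Set (Euc n)) ∩ Metric.closedBall 0 1) ∂P := by
  have hm : Measurable fun F : Closeds (Euc n) =>
      (2 : ℝ) ^ minBodies ((F : Set (Euc n)) ∩ Metric.closedBall t 1) :=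
    (measurable_from_nat (f := fun k => (2 : ℝ) ^ k)).comp
      (measurable_minBodies_inter (isCompact_closedBall t 1))
  have hm0 : Measurable fun F : Closeds (Euc n) =>
      (2 : ℝ) ^ minBodies ((F : Set (Euc n)) ∩ Metric.closedBall 0 1) :=
    (measurable_from_nat (f := fun k => (2 : ℝ) ^ k)).comp
      (measurable_minBodies_inter (isCompact_closedBall 0 1))
  have hid := (hZ.identDistrib t).comp hm
  have e : ((fun F : Closeds (Euc n) =>
      (2 : ℝ) ^ minBodies ((F : Set (Euc n)) ∩ Metric.closedBall t 1)) ∘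
        fun ω => translateClosed t (Z ω)) = fun ω =>
      (2 : ℝ) ^ minBodies ((Z ω : Set (Euc n)) ∩ Metric.closedBall 0 1) := by
    ext ω
    simp only [Function.comp_apply]
    have := coe_translateClosed_inter t (Z ω) (Metric.closedBall 0 1)
    rw [image_add_closedBall, zero_add] at this
    rw [this, minBodies_image_add]
  rw [e] at hid
  have h0 : Integrable (fun ω => (2 : ℝ) ^ minBodies ((Z ω : Set (Euc n)) ∩
      Metric.closedBall 0 1)) P := by
    refine ⟨(hm0.comp hZ.measurable).aestronglyMeasurable, ?_⟩
    rw [hasFiniteIntegral_iff_enorm]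
    convert hZ.lintegral_lt_top using 2
    ext ω
    rw [enorm_pow, ← ofReal_norm]
    simp
  exact ⟨hid.integrable_iff.1 h0, hid.integral_eq.symm⟩

theorem IsStandardRandomSet.aestronglyMeasurable (hZ : IsStandardRandomSet P Z)
    {φ : ConvexBody (Euc n) → ℝ} (hφ : IsVal φ) {W : Set (Euc n)} (hW : CompactConvex W) :
    AEStronglyMeasurable (fun ω => convexRingExt φ ((Z ω : Set (Euc n)) ∩ W)) P := by
  refine ((hφ.measurable_ringValue_inter hW.1).comp hZ.measurable).aestronglyMeasurable.congr ?_
  filter_upwards [hZ.ae_mem] with ω hω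
  exact ringValue_of_mem (mem_extendedConvexRing_inter hω hW)

/-- The expected absolute value of the additive extension on a compact convex set is bounded in
terms of the number of unit balls needed to cover the set. -/
theorem IsStandardRandomSet.exists_integral_bound [IsProbabilityMeasure P]
    (hZ : IsStandardRandomSet P Z) {φ : ConvexBody (Euc n) → ℝ} (hφ : IsVal φ) :
    ∃ b : ℕ → ℝ, (∀ m, 0 ≤ b m) ∧ ∀ (s : Finset (Euc n)) (W : Set (Euc n)), CompactConvex W →
      W ⊆ ⋃ t ∈ s, Metric.closedBall t 1 →
      Integrable (fun ω => convexRingExt φ ((Z ω : Set (Euc n)) ∩ W)) P ∧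
      ∫ ω, |convexRingExt φ ((Z ω : Set (Euc n)) ∩ W)| ∂P ≤ b s.card := by
  obtain ⟨Λ, hΛ⟩ := hφ.exists_represents
  obtain ⟨c, hc0, hc⟩ := hφ.exists_bound
  refine ⟨fun m => 2 ^ m * c * (m * ∫ ω, (2 : ℝ) ^ minBodies ((Z ω : Set (Euc n)) ∩
    Metric.closedBall 0 1) ∂P), fun m => ?_, fun s W hW hWs => ?_⟩
  · have : 0 ≤ ∫ ω, (2 : ℝ) ^ minBodies ((Z ω : Set (Euc n)) ∩ Metric.closedBall 0 1) ∂P :=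
      integral_nonneg fun ω => by positivity
    positivity
  have hbound : ∀ᵐ ω ∂P, |convexRingExt φ ((Z ω : Set (Euc n)) ∩ W)| ≤
      2 ^ s.card * c * ∑ t ∈ s, 2 ^ minBodies ((Z ω : Set (Euc n)) ∩ Metric.closedBall t 1) := by
    filter_upwards [hZ.ae_mem] with ω hω
    rw [hΛ.convexRingExt_eq hφ (mem_extendedConvexRing_inter hω hW)]
    exact hΛ.abs_le_of_subset_biUnion hc hω hW s hWs
  have hint : Integrable (fun ω => 2 ^ s.card * c *
      ∑ t ∈ s, (2 : ℝ) ^ minBodies ((Z ω : Set (Euc n)) ∩ Metric.closedBall t 1)) P :=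
    (integrable_finsetSum _ fun t _ => (hZ.integrable_minBodies t).1).const_mul _
  have hI : Integrable (fun ω => convexRingExt φ ((Z ω : Set (Euc n)) ∩ W)) P :=
    hint.mono' (hZ.aestronglyMeasurable hφ hW) hbound
  refine ⟨hI, (integral_mono_ae hI.abs hint hbound).trans (le_of_eq ?_)⟩
  rw [integral_const_mul, integral_finsetSum _ fun t _ => (hZ.integrable_minBodies t).1,
    Finset.sum_congr rfl fun t _ => (hZ.integrable_minBodies t).2, Finset.sum_const, nsmul_eq_mul]

theorem IsStandardRandomSet.integrable [IsProbabilityMeasure P]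
    (hZ : IsStandardRandomSet P Z) {φ : ConvexBody (Euc n) → ℝ} (hφ : IsVal φ)
    {W : Set (Euc n)} (hW : CompactConvex W) :
    Integrable (fun ω => convexRingExt φ ((Z ω : Set (Euc n)) ∩ W)) P := by
  obtain ⟨b, -, hb⟩ := hZ.exists_integral_bound hφ
  obtain ⟨s, -, hs⟩ := hW.1.elim_nhds_subcover (fun t => Metric.closedBall t 1)
    fun t _ => Metric.closedBall_mem_nhds t one_pos
  exact (hb s W hW hs).1

theorem inter_biUnion_mem_convexRing {F : Set (Euc n)} (hF : F ∈ extendedConvexRing n)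
    {ι : Type*} (s : Finset ι) {S : ι → Set (Euc n)} (hS : ∀ i ∈ s, CompactConvex (S i)) :
    F ∩ ⋃ i ∈ s, S i ∈ convexRing n := by
  rw [inter_iUnion₂]
  exact biUnion_mem_convexRing_of_mem s fun i hi => mem_extendedConvexRing_inter hF (hS i hi)

/-- Inclusion-exclusion carries integrability and bounds from convex windows to finite unions, such
as the upper right boundary of a cube. -/
theorem IsStandardRandomSet.integrable_biUnion [IsProbabilityMeasure P]
    (hZ : IsStandardRandomSet P Z) {φ : ConvexBody (Euc n) → ℝ} (hφ : IsVal φ)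
    {ι : Type*} (s : Finset ι) {S : ι → Set (Euc n)} (hS : ∀ i ∈ s, CompactConvex (S i))
    {C : ℝ} (hC : ∀ u ⊆ s, u.Nonempty →
      ∫ ω, |convexRingExt φ ((Z ω : Set (Euc n)) ∩ ⋂ i ∈ u, S i)| ∂P ≤ C) :
    Integrable (fun ω => convexRingExt φ ((Z ω : Set (Euc n)) ∩ ⋃ i ∈ s, S i)) P ∧
      |∫ ω, convexRingExt φ ((Z ω : Set (Euc n)) ∩ ⋃ i ∈ s, S i) ∂P| ≤
        (s.powerset.filter Finset.Nonempty).card * C := by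
  obtain ⟨Λ, hΛ⟩ := hφ.exists_represents
  have hcc : ∀ u ∈ s.powerset.filter Finset.Nonempty, CompactConvex (⋂ i ∈ u, S i) := by
    intro u hu
    obtain ⟨hus, hu'⟩ := Finset.mem_filter.1 hu
    exact CompactConvex.biInter hu' fun i hi => hS i (Finset.mem_powerset.1 hus hi)
  have hae : (fun ω => ∑ u ∈ s.powerset with u.Nonempty, (-1 : ℝ) ^ (u.card + 1) *
      convexRingExt φ ((Z ω : Set (Euc n)) ∩ ⋂ i ∈ u, S i)) =ᵐ[P]
      fun ω => convexRingExt φ ((Z ω : Set (Euc n)) ∩ ⋃ i ∈ s, S i) := by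
    filter_upwards [hZ.ae_mem] with ω hω
    rw [hΛ.convexRingExt_eq hφ (inter_biUnion_mem_convexRing hω s hS), inter_iUnion₂,
      dual_indicator_biUnion]
    refine Finset.sum_congr rfl fun u hu => ?_
    rw [hΛ.convexRingExt_eq hφ (mem_extendedConvexRing_inter hω (hcc u hu))]
    obtain ⟨j, hj⟩ := (Finset.mem_filter.1 hu).2
    congr 3
    ext x
    simp only [mem_inter_iff, mem_iInter]
    exact ⟨fun h i hi => ⟨h.1, h.2 i hi⟩, fun h => ⟨(h j hj).1, fun i hi => (h i hi).2⟩⟩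
  have hint : ∀ u ∈ s.powerset.filter Finset.Nonempty, Integrable (fun ω =>
      (-1 : ℝ) ^ (u.card + 1) * convexRingExt φ ((Z ω : Set (Euc n)) ∩ ⋂ i ∈ u, S i)) P :=
    fun u hu => (hZ.integrable hφ (hcc u hu)).const_mul _
  refine ⟨(integrable_finsetSum _ hint).congr hae, ?_⟩
  rw [← integral_congr_ae hae, integral_finsetSum _ hint]
  refine (Finset.abs_sum_le_sum_abs _ _).trans ?_
  rw [← nsmul_eq_mul]
  refine Finset.sum_le_card_nsmul _ _ _ fun u hu => ?_
  obtain ⟨hus, hu'⟩ := Finset.mem_filter.1 hu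
  refine le_trans ?_ (hC u (Finset.mem_powerset.1 hus) hu')
  refine (abs_integral_le_integral_abs).trans (le_of_eq ?_)
  simp [abs_mul]

end Expectation

/-! ### Lattice cubes and their upper right boundaries. -/

section Cubes

variable {n : ℕ}

/-- The closed unit cube with lower left corner `z`. -/
def cubeAt (z : Euc n) : Set (Euc n) := {x | ∀ i, z i ≤ x i ∧ x i ≤ z i + 1}

/-- The half-open unit cube with lower left corner `z`. -/
def halfOpenCubeAt (z : Euc n) : Set (Euc n) := {x | ∀ i, z i ≤ x i ∧ x i < z i + 1}

/-- The upper right boundary of the cube with lower left corner `z`. -/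
def upperBoundaryAt (z : Euc n) : Set (Euc n) := cubeAt z \ halfOpenCubeAt z

/-- The faces that make up the upper right boundary. -/
def faceAt (z : Euc n) (i : Fin n) : Set (Euc n) := cubeAt z ∩ {x | x i = z i + 1}

theorem halfOpenCubeAt_subset (z : Euc n) : halfOpenCubeAt z ⊆ cubeAt z :=
  fun _ hx i => ⟨(hx i).1, (hx i).2.le⟩

theorem upperBoundaryAt_eq (z : Euc n) :
    upperBoundaryAt z = ⋃ i ∈ (Finset.univ : Finset (Fin n)), faceAt z i := by
  ext x
  simp only [upperBoundaryAt, halfOpenCubeAt, faceAt, Set.mem_sdiff, mem_ofPred_eq, not_forall,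
    not_and, not_lt, Finset.mem_univ, iUnion_true, mem_iUnion, mem_inter_iff, exists_and_left]
  refine and_congr_right fun hx => exists_congr fun i => ?_
  exact ⟨fun h => le_antisymm (hx i).2 (h (hx i).1), fun h _ => h.ge⟩

theorem cubeAt_zero : cubeAt (0 : Euc n) = unitCube n := by
  simp [cubeAt, unitCube]

theorem upperBoundaryAt_zero : upperBoundaryAt (0 : Euc n) = upperRightBoundary n := by
  simp [upperBoundaryAt, upperRightBoundary, cubeAt, halfOpenCubeAt, unitCube, halfOpenCube]

theorem image_add_cubeAt (z t : Euc n) : (fun x => x + t) '' cubeAt z = cubeAt (z + t) := by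
  ext x
  rw [image_add_right, mem_preimage]
  refine forall_congr' fun i => ?_
  simp only [PiLp.add_apply, PiLp.neg_apply]
  constructor <;> rintro ⟨h1, h2⟩ <;> constructor <;> linarith

theorem image_add_halfOpenCubeAt (z t : Euc n) :
    (fun x => x + t) '' halfOpenCubeAt z = halfOpenCubeAt (z + t) := by
  ext x
  rw [image_add_right, mem_preimage]
  refine forall_congr' fun i => ?_
  simp only [PiLp.add_apply, PiLp.neg_apply]
  constructor <;> rintro ⟨h1, h2⟩ <;> constructor <;> linarith

theorem image_add_upperBoundaryAt (z t : Euc n) :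
    (fun x => x + t) '' upperBoundaryAt z = upperBoundaryAt (z + t) := by
  rw [upperBoundaryAt, image_sdiff (add_left_injective t), image_add_cubeAt,
    image_add_halfOpenCubeAt, upperBoundaryAt]

theorem dist_le_of_mem_cubeAt {z x y : Euc n} (hx : x ∈ cubeAt z) (hy : y ∈ cubeAt z) :
    ‖x - y‖ ≤ √n := by
  rw [EuclideanSpace.norm_eq]
  refine Real.sqrt_le_sqrt ?_
  have : ∀ i ∈ Finset.univ, ‖(x - y) i‖ ^ 2 ≤ 1 := fun i _ => by
    rw [Real.norm_eq_abs, sq_abs, PiLp.sub_apply, sq_le_one_iff_abs_le_one, abs_le]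
    have h1 := hx i
    have h2 := hy i
    constructor <;> linarith
  simpa using Finset.sum_le_sum this

theorem compactConvex_cubeAt (z : Euc n) : CompactConvex (cubeAt z) := by
  have hcl : IsClosed (cubeAt z) := by
    simp only [cubeAt, ofPred_forall, ofPred_and]
    exact isClosed_iInter fun i => (isClosed_le continuous_const (by fun_prop)).inter
      (isClosed_le (by fun_prop) continuous_const)
  refine ⟨Metric.isCompact_of_isClosed_isBounded hcl ?_, ?_⟩
  · refine Metric.isBounded_closedBall.subset (fun x hx => ?_ : cubeAt z ⊆ Metric.closedBall z √n)
    rw [Metric.mem_closedBall, dist_eq_norm]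
    exact dist_le_of_mem_cubeAt hx fun i => ⟨le_rfl, by linarith⟩
  · intro x hx y hy a b ha hb hab i
    have h1 := hx i
    have h2 := hy i
    simp only [PiLp.add_apply, PiLp.smul_apply, smul_eq_mul]
    have e : z i = a * z i + b * z i := by rw [← add_mul, hab, one_mul]
    constructor
    · nlinarith
    · nlinarith

theorem compactConvex_faceAt (z : Euc n) (i : Fin n) : CompactConvex (faceAt z i) :=
  (compactConvex_cubeAt z).inter_eq (EuclideanSpace.proj i : StrongDual ℝ (Euc n)) (z i + 1)

/-- Integer vectors as points of Euclidean space. -/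
def intVec (z : Fin n → ℤ) : Euc n := WithLp.toLp 2 fun i => (z i : ℝ)

@[simp]
theorem intVec_apply (z : Fin n → ℤ) (i : Fin n) : intVec z i = z i := rfl

theorem mem_halfOpenCubeAt_intVec {z : Fin n → ℤ} {x : Euc n} :
    x ∈ halfOpenCubeAt (intVec z) ↔ z = fun i => ⌊x i⌋ := by
  simp only [halfOpenCubeAt, mem_ofPred_eq, intVec_apply, funext_iff, eq_comm (a := z _),
    Int.floor_eq_iff]

theorem volume_halfOpenCubeAt (z : Euc n) : volume (halfOpenCubeAt z) = 1 := by
  have h : halfOpenCubeAt z = (WithLp.ofLp : Euc n → Fin n → ℝ) ⁻¹'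
      (univ.pi fun i => Ico (z i) (z i + 1)) := by
    ext x
    simp [halfOpenCubeAt]
  rw [h, (PiLp.volume_preserving_ofLp (Fin n)).measure_preimage
    (MeasurableSet.univ_pi fun i => measurableSet_Ico).nullMeasurableSet, Real.volume_pi_Ico]
  simp

theorem measurableSet_halfOpenCubeAt (z : Euc n) : MeasurableSet (halfOpenCubeAt z) := by
  simp only [halfOpenCubeAt, ofPred_forall, ofPred_and]
  exact .iInter fun i => (measurableSet_le measurable_const (by fun_prop)).inter
    (measurableSet_lt (by fun_prop) measurable_const)

theorem volume_biUnion_halfOpenCubeAt (T : Finset (Fin n → ℤ)) :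
    volume (⋃ z ∈ T, halfOpenCubeAt (intVec z)) = T.card := by
  rw [measure_biUnion_finset ?_ fun z _ => measurableSet_halfOpenCubeAt _]
  · simp [volume_halfOpenCubeAt]
  · intro z _ w _ hzw
    refine disjoint_left.2 fun x hx hx' => hzw ?_
    rw [mem_halfOpenCubeAt_intVec.1 hx, mem_halfOpenCubeAt_intVec.1 hx']

end Cubes

/-! ### Counting lattice cubes in dilated bodies. -/

section Counting

variable {n : ℕ}

/-- The frontier of a convex set is a null set. -/
theorem Convex.interior_nonempty_of_volume_pos {K : Set (Euc n)} (hK : Convex ℝ K)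
    (hv : 0 < volume K) : (interior K).Nonempty := by
  rw [nonempty_iff_ne_empty]
  intro h
  have h0 := hK.addHaar_frontier volume
  rw [frontier, h, sdiff_empty] at h0
  exact hv.ne' (measure_mono_null subset_closure h0)

theorem finite_halfOpenCubeAt_inter {W : Set (Euc n)} (hW : Bornology.IsBounded W) :
    {z : Fin n → ℤ | (halfOpenCubeAt (intVec z) ∩ W).Nonempty}.Finite := by
  obtain ⟨R, hR⟩ := hW.subset_closedBall (0 : Euc n)
  refine (Set.Finite.pi' fun _ : Fin n => finite_Icc ⌊-R⌋ ⌊R⌋).subset ?_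
  rintro z ⟨x, hx, hxW⟩ i
  rw [mem_halfOpenCubeAt_intVec.1 hx]
  have h1 : |x i| ≤ R := (PiLp.norm_apply_le x i).trans (by simpa using hR hxW)
  exact ⟨Int.floor_le_floor (abs_le.1 h1).1, Int.floor_le_floor (abs_le.1 h1).2⟩

theorem volume_image_add (W : Set (Euc n)) (t : Euc n) :
    volume ((fun x => x + t) '' W) = volume W := by
  rw [image_add_right, measure_preimage_add_right]

theorem toReal_volume_smul {K : Set (Euc n)} {r : ℝ} (hr : 0 ≤ r) :
    (volume (r • K)).toReal = r ^ n * (volume K).toReal := by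
  rw [Measure.addHaar_smul, finrank_euclideanSpace_fin, ENNReal.toReal_mul,
    ENNReal.toReal_ofReal (abs_nonneg _), abs_of_nonneg (by positivity)]

/-- The number of lattice cubes that meet a dilated convex body, and the number of those that are
contained in it, are asymptotically equal to its volume. -/
theorem exists_lattice_cubes {K : Set (Euc n)} (hK : CompactConvex K) (hv : 0 < volume K) :
    ∃ a : ℝ, 0 < a ∧ ∀ r, a < r → ∃ T I : Finset (Fin n → ℤ), I ⊆ T ∧
      r • K ⊆ ⋃ z ∈ T, halfOpenCubeAt (intVec z) ∧
      (∀ z ∈ I, cubeAt (intVec z) ⊆ r • K) ∧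
      (r - a) ^ n * (volume K).toReal ≤ I.card ∧
      (T.card : ℝ) ≤ (r + a) ^ n * (volume K).toReal := by
  classical
  obtain ⟨x₀, hx₀⟩ := hK.2.interior_nonempty_of_volume_pos hv
  obtain ⟨ρ, hρ, hball⟩ := Metric.nhds_basis_closedBall.mem_iff.1 (mem_interior_iff_mem_nhds.1 hx₀)
  have hd : 0 < √(n : ℝ) + 1 := by positivity
  set a := (√(n : ℝ) + 1) / ρ with ha
  have ha0 : 0 < a := by positivity
  -- The set `a • K` contains the ball of radius `a * ρ = √n + 1` about `a • x₀`, while `√n` bounds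
  -- the diameter of a unit cube.
  have hshift : ∀ w : Euc n, ‖w‖ ≤ √n → w + a • x₀ ∈ a • K := by
    intro w hw
    refine ⟨x₀ + a⁻¹ • w, hball ?_, ?_⟩
    · rw [Metric.mem_closedBall, dist_eq_norm, add_sub_cancel_left, norm_smul, norm_inv,
        Real.norm_eq_abs, abs_of_pos ha0, inv_mul_le_iff₀ ha0, ha, div_mul_cancel₀ _ hρ.ne']
      linarith
    · simp only [smul_add, smul_smul, mul_inv_cancel₀ ha0.ne', one_smul]
      exact add_comm _ _
  refine ⟨a, ha0, fun r hr => ?_⟩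
  have hr0 : 0 < r := ha0.trans hr
  have hrK : CompactConvex (r • K) := ⟨hK.1.smul r, hK.2.smul r⟩
  let T := (finite_halfOpenCubeAt_inter hrK.1.isBounded).toFinset
  have hT : ∀ z, z ∈ T ↔ (halfOpenCubeAt (intVec z) ∩ r • K).Nonempty := by simp [T]
  let I := T.filter fun z => cubeAt (intVec z) ⊆ r • K
  refine ⟨T, I, Finset.filter_subset _ _, fun x hx => ?_, fun z hz => (Finset.mem_filter.1 hz).2,
    ?_, ?_⟩
  · have hxz : x ∈ halfOpenCubeAt (intVec fun i => ⌊x i⌋) := mem_halfOpenCubeAt_intVec.2 rfl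
    exact mem_biUnion (Finset.mem_coe.2 ((hT _).2 ⟨x, hxz, hx⟩)) hxz
  -- By convexity `r • K = (r - a) • K + a • K`, so a cube meeting the shifted copy of `(r - a) • K`
  -- lies entirely in `r • K`.
  · have hsub : (fun x => x + a • x₀) '' ((r - a) • K) ⊆
        ⋃ z ∈ I, halfOpenCubeAt (intVec z) := by
      rintro _ ⟨y, hy, rfl⟩
      set x := y + a • x₀ with hx
      have hxz : x ∈ halfOpenCubeAt (intVec fun i => ⌊x i⌋) := mem_halfOpenCubeAt_intVec.2 rfl
      have hcube : cubeAt (intVec fun i => ⌊x i⌋) ⊆ r • K := by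
        intro w hw
        have h1 := hshift (w - x) (dist_le_of_mem_cubeAt hw (halfOpenCubeAt_subset _ hxz))
        have h2 : w = y + (w - x + a • x₀) := by rw [hx]; abel
        rw [h2, show r = (r - a) + a by ring, hK.2.add_smul (by linarith) ha0.le]
        exact add_mem_add hy h1
      refine mem_biUnion (Finset.mem_coe.2 (Finset.mem_filter.2 ⟨(hT _).2 ?_, hcube⟩)) hxz
      exact ⟨x, hxz, hcube (halfOpenCubeAt_subset _ hxz)⟩
    have := measure_mono (μ := volume) hsub
    rw [volume_image_add, volume_biUnion_halfOpenCubeAt] at this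
    have := ENNReal.toReal_mono (by simp) this
    rwa [toReal_volume_smul (by linarith), ENNReal.toReal_natCast] at this
  · have hsub : (fun x => x + a • x₀) '' (⋃ z ∈ T, halfOpenCubeAt (intVec z)) ⊆ (r + a) • K := by
      rintro _ ⟨x, hx, rfl⟩
      obtain ⟨z, hz, hxz⟩ := mem_iUnion₂.1 hx
      obtain ⟨y, hyz, hy⟩ := (hT z).1 hz
      have h1 := hshift (x - y) (dist_le_of_mem_cubeAt (halfOpenCubeAt_subset _ hxz)
        (halfOpenCubeAt_subset _ hyz))
      have h2 : x + a • x₀ = y + (x - y + a • x₀) := by abel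
      rw [hK.2.add_smul hr0.le ha0.le]
      simp only [h2]
      exact add_mem_add hy h1
    have := measure_mono (μ := volume) hsub
    rw [volume_image_add, volume_biUnion_halfOpenCubeAt] at this
    have := ENNReal.toReal_mono (hK.1.smul (r + a)).measure_lt_top.ne this
    rwa [toReal_volume_smul (by linarith), ENNReal.toReal_natCast] at this

/-- A sequence that is controlled by counts of lattice cubes has a limit. -/
theorem tendsto_div_of_lattice_bounds {f : ℝ → ℝ} {m c v a : ℝ} (hv : 0 < v) (ha : 0 < a)
    (hc : 0 ≤ c)
    (h : ∀ r, a < r → ∃ i t : ℝ, i ≤ t ∧ (r - a) ^ n * v ≤ i ∧ t ≤ (r + a) ^ n * v ∧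
      |f r - i * m| ≤ (t - i) * c) :
    Tendsto (fun r => f r / (r ^ n * v)) atTop (𝓝 m) := by
  have hlim : Tendsto (fun r : ℝ => (c + |m|) * ((1 + a * r⁻¹) ^ n - (1 - a * r⁻¹) ^ n)) atTop
      (𝓝 ((c + |m|) * ((1 + a * 0) ^ n - (1 - a * 0) ^ n))) := by
    have h0 := tendsto_inv_atTop_zero (𝕜 := ℝ)
    exact (((h0.const_mul a).const_add 1).pow n |>.sub
      (((h0.const_mul a).const_sub 1).pow n)).const_mul _
  simp only [mul_zero, add_zero, sub_zero, sub_self] at hlim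
  rw [tendsto_iff_norm_sub_tendsto_zero]
  refine squeeze_zero' (Eventually.of_forall fun _ => norm_nonneg _) ?_ hlim
  filter_upwards [eventually_gt_atTop a] with r hr
  obtain ⟨i, t, hit, hi, ht, hf⟩ := h r hr
  have hr0 : 0 < r := ha.trans hr
  have hV : 0 < r ^ n * v := by positivity
  have h1 : (r - a) ^ n ≤ r ^ n := pow_le_pow_left₀ (by linarith) (by linarith) n
  have h2 : r ^ n ≤ (r + a) ^ n := pow_le_pow_left₀ hr0.le (by linarith) n
  have h1' : (r - a) ^ n * v ≤ r ^ n * v := by gcongr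
  have h2' : r ^ n * v ≤ (r + a) ^ n * v := by gcongr
  have e1 : (1 + a * r⁻¹) ^ n = (r + a) ^ n / r ^ n := by
    rw [← div_pow]; congr 1; field_simp
  have e2 : (1 - a * r⁻¹) ^ n = (r - a) ^ n / r ^ n := by
    rw [← div_pow]; congr 1; field_simp
  rw [Real.norm_eq_abs, div_sub' hV.ne', abs_div, abs_of_pos hV, div_le_iff₀ hV, e1, e2]
  have e3 : (c + |m|) * ((r + a) ^ n / r ^ n - (r - a) ^ n / r ^ n) * (r ^ n * v) =
      (c + |m|) * ((r + a) ^ n * v - (r - a) ^ n * v) := by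
    field_simp
  rw [e3]
  -- The first part is the contribution of the `t - i` boundary cubes, the second the error in
  -- counting interior ones; both counts are at most the gap between the two volume bounds.
  have e4 : f r - r ^ n * v * m = (f r - i * m) + (i - r ^ n * v) * m := by ring
  rw [e4]
  refine (abs_add_le _ _).trans ?_
  rw [abs_mul, add_mul]
  have h5 : |i - r ^ n * v| ≤ (r + a) ^ n * v - (r - a) ^ n * v := by
    rw [abs_le]
    constructor <;> linarith
  have h6 : (t - i) * c ≤ c * ((r + a) ^ n * v - (r - a) ^ n * v) := by
    rw [mul_comm]
    gcongr
  have h7 : |i - r ^ n * v| * |m| ≤ |m| * ((r + a) ^ n * v - (r - a) ^ n * v) := by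
    rw [mul_comm]
    gcongr
  linarith

end Counting

/-! ### The mean value as an expectation on the half-open cube. -/

section Limit

open ProbabilityTheory

variable {n : ℕ} {Ω : Type*} [MeasurableSpace Ω] {P : Measure Ω} {Z : Ω → Closeds (Euc n)}
  {φ : ConvexBody (Euc n) → ℝ}

theorem inter_upperBoundaryAt (W : Set (Euc n)) (z : Euc n) :
    W ∩ upperBoundaryAt z = ⋃ i ∈ (Finset.univ : Finset (Fin n)), W ∩ faceAt z i := by
  rw [upperBoundaryAt_eq, inter_iUnion₂]

/-- Translating one finite cover of the unit cube keeps its cardinality, which makes the bound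
uniform in `z`. -/
theorem IsStandardRandomSet.exists_integral_bound_cubeAt [IsProbabilityMeasure P]
    (hZ : IsStandardRandomSet P Z) (hφ : IsVal φ) :
    ∃ b : ℝ, 0 ≤ b ∧ ∀ (z : Euc n) (W : Set (Euc n)), CompactConvex W → W ⊆ cubeAt z →
      ∫ ω, |convexRingExt φ ((Z ω : Set (Euc n)) ∩ W)| ∂P ≤ b := by
  obtain ⟨b, hb0, hb⟩ := hZ.exists_integral_bound hφ
  obtain ⟨s, -, hs⟩ := (compactConvex_cubeAt (0 : Euc n)).1.elim_nhds_subcover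
    (fun t => Metric.closedBall t 1) fun t _ => Metric.closedBall_mem_nhds t one_pos
  refine ⟨b s.card, hb0 _, fun z W hW hWz => ?_⟩
  have hcov : W ⊆ ⋃ t ∈ s.map (addRightEmbedding z), Metric.closedBall t 1 := by
    refine hWz.trans ?_
    have := image_mono (f := fun x => x + z) hs
    rw [image_add_cubeAt, zero_add, image_iUnion₂] at this
    simpa [image_add_closedBall] using this
  simpa using (hb _ W hW hcov).2

theorem IsStandardRandomSet.exists_bound_halfOpenCubeAt [IsProbabilityMeasure P]
    (hZ : IsStandardRandomSet P Z) (hφ : IsVal φ) :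
    ∃ c : ℝ, 0 ≤ c ∧ ∀ (z : Euc n) (W : Set (Euc n)), CompactConvex W →
      |∫ ω, convexRingExt φ ((Z ω : Set (Euc n)) ∩ (W ∩ cubeAt z)) ∂P -
        ∫ ω, convexRingExt φ ((Z ω : Set (Euc n)) ∩ (W ∩ upperBoundaryAt z)) ∂P| ≤ c := by
  obtain ⟨b, hb0, hb⟩ := hZ.exists_integral_bound_cubeAt hφ
  refine ⟨b + ((Finset.univ : Finset (Fin n)).powerset.filter Finset.Nonempty).card * b,
    by positivity, fun z W hW => (abs_sub _ _).trans (add_le_add ?_ ?_)⟩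
  · exact abs_integral_le_integral_abs.trans
      (hb z _ (hW.inter (compactConvex_cubeAt z)) inter_subset_right)
  · rw [inter_upperBoundaryAt]
    refine (hZ.integrable_biUnion hφ _ (fun i _ => hW.inter (compactConvex_faceAt z i)) ?_).2
    rintro u - ⟨j, hj⟩
    refine hb z _ (CompactConvex.biInter ⟨j, hj⟩ fun i _ => hW.inter (compactConvex_faceAt z i)) ?_
    exact subset_trans (iInter₂_subset j hj) (inter_subset_right.trans inter_subset_left)

theorem IsStandardRandomSet.integrable_inter_upperBoundaryAt [IsProbabilityMeasure P]
    (hZ : IsStandardRandomSet P Z) (hφ : IsVal φ) (z : Euc n) {W : Set (Euc n)}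
    (hW : CompactConvex W) :
    Integrable (fun ω => convexRingExt φ ((Z ω : Set (Euc n)) ∩ (W ∩ upperBoundaryAt z))) P := by
  obtain ⟨b, hb0, hb⟩ := hZ.exists_integral_bound_cubeAt hφ
  rw [inter_upperBoundaryAt]
  refine (hZ.integrable_biUnion hφ _ (fun i _ => hW.inter (compactConvex_faceAt z i))
    (C := b) ?_).1
  rintro u - ⟨j, hj⟩
  refine hb z _ (CompactConvex.biInter ⟨j, hj⟩ fun i _ => hW.inter (compactConvex_faceAt z i)) ?_
  exact subset_trans (iInter₂_subset j hj) (inter_subset_right.trans inter_subset_left)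

/-- By stationarity, expected values do not change when the observation window is translated. -/
theorem IsStandardRandomSet.integral_image_add [IsProbabilityMeasure P]
    (hZ : IsStandardRandomSet P Z) (hφ : IsVal φ) {D : Set (Euc n)} (hD : IsCompact D)
    (hmem : ∀ F ∈ extendedConvexRing n, F ∩ D ∈ convexRing n)
    (t : Euc n) (hmem' : ∀ F ∈ extendedConvexRing n, F ∩ (fun x => x + t) '' D ∈ convexRing n) :
    ∫ ω, convexRingExt φ ((Z ω : Set (Euc n)) ∩ (fun x => x + t) '' D) ∂P =
      ∫ ω, convexRingExt φ ((Z ω : Set (Euc n)) ∩ D) ∂P := by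
  -- Equality in law needs a function measurable on all closed sets; `ringValue` is one, and it
  -- agrees almost surely with the extension.
  have hm := hφ.measurable_ringValue_inter (hD.image (continuous_add_const t))
  have hid := ((hZ.identDistrib t).comp hm).integral_eq
  have e1 : ∫ ω, convexRingExt φ ((Z ω : Set (Euc n)) ∩ (fun x => x + t) '' D) ∂P =
      ∫ ω, ringValue φ ((Z ω : Set (Euc n)) ∩ (fun x => x + t) '' D) ∂P := by
    refine integral_congr_ae ?_
    filter_upwards [hZ.ae_mem] with ω hω
    exact (ringValue_of_mem (hmem' _ hω)).symm
  rw [e1]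
  refine hid.symm.trans (integral_congr_ae ?_)
  filter_upwards [hZ.ae_mem] with ω hω
  simp only [Function.comp_apply]
  rw [coe_translateClosed_inter, ringValue_of_mem (image_add_mem_convexRing (hmem _ hω) t),
    hφ.convexRingExt_image_add (hmem _ hω)]

theorem mem_convexRing_inter_upperBoundaryAt {F W : Set (Euc n)} (hF : F ∈ extendedConvexRing n)
    (hW : CompactConvex W) (z : Euc n) : F ∩ (W ∩ upperBoundaryAt z) ∈ convexRing n := by
  rw [inter_upperBoundaryAt]
  exact inter_biUnion_mem_convexRing hF _ fun i _ => hW.inter (compactConvex_faceAt z i)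

theorem cubeAt_inter_upperBoundaryAt (z : Euc n) :
    cubeAt z ∩ upperBoundaryAt z = upperBoundaryAt z := inter_eq_right.2 sdiff_subset

theorem IsStandardRandomSet.integral_cubeAt [IsProbabilityMeasure P]
    (hZ : IsStandardRandomSet P Z) (hφ : IsVal φ) (z : Euc n) :
    ∫ ω, convexRingExt φ ((Z ω : Set (Euc n)) ∩ cubeAt z) ∂P -
      ∫ ω, convexRingExt φ ((Z ω : Set (Euc n)) ∩ upperBoundaryAt z) ∂P =
    ∫ ω, convexRingExt φ ((Z ω : Set (Euc n)) ∩ cubeAt 0) ∂P -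
      ∫ ω, convexRingExt φ ((Z ω : Set (Euc n)) ∩ upperBoundaryAt 0) ∂P := by
  have hub : ∀ (z : Euc n), ∀ F ∈ extendedConvexRing n, F ∩ upperBoundaryAt z ∈ convexRing n := by
    intro z F hF
    rw [← cubeAt_inter_upperBoundaryAt]
    exact mem_convexRing_inter_upperBoundaryAt hF (compactConvex_cubeAt z) z
  have hcpt : IsCompact (upperBoundaryAt (0 : Euc n)) := by
    rw [upperBoundaryAt_eq]
    exact Finset.univ.isCompact_biUnion fun i _ => (compactConvex_faceAt 0 i).1
  have h1 := hZ.integral_image_add hφ (compactConvex_cubeAt (0 : Euc n)).1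
    (fun F hF => mem_extendedConvexRing_inter hF (compactConvex_cubeAt 0)) z
    (fun F hF => mem_extendedConvexRing_inter hF ((compactConvex_cubeAt 0).image_add_right z))
  have h2 := hZ.integral_image_add hφ hcpt (hub 0) z (by
    rw [image_add_upperBoundaryAt]
    exact hub _)
  rw [image_add_cubeAt, zero_add] at h1
  rw [image_add_upperBoundaryAt, zero_add] at h2
  rw [h1, h2]

theorem IsStandardRandomSet.integrable_valueOnHalfOpenCube [IsProbabilityMeasure P]
    (hZ : IsStandardRandomSet P Z) (hφ : IsVal φ) :
    Integrable (fun ω => valueOnHalfOpenCube φ (Z ω : Set (Euc n))) P ∧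
    ∫ ω, valueOnHalfOpenCube φ (Z ω : Set (Euc n)) ∂P =
      ∫ ω, convexRingExt φ ((Z ω : Set (Euc n)) ∩ cubeAt 0) ∂P -
        ∫ ω, convexRingExt φ ((Z ω : Set (Euc n)) ∩ upperBoundaryAt 0) ∂P := by
  have h1 := hZ.integrable hφ (compactConvex_cubeAt (0 : Euc n))
  have h2 := hZ.integrable_inter_upperBoundaryAt hφ 0 (compactConvex_cubeAt (0 : Euc n))
  rw [cubeAt_inter_upperBoundaryAt] at h2
  simp only [valueOnHalfOpenCube, ← cubeAt_zero, ← upperBoundaryAt_zero]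
  exact ⟨h1.sub h2, integral_sub h1 h2⟩

/-- Additivity over a partition into half-open lattice cubes. -/
theorem IsVal.convexRingExt_eq_sum (hφ : IsVal φ) {F W : Set (Euc n)}
    (hF : F ∈ extendedConvexRing n) (hW : CompactConvex W) (T : Finset (Fin n → ℤ))
    (hT : W ⊆ ⋃ z ∈ T, halfOpenCubeAt (intVec z)) :
    convexRingExt φ (F ∩ W) = ∑ z ∈ T, (convexRingExt φ (F ∩ (W ∩ cubeAt (intVec z))) -
      convexRingExt φ (F ∩ (W ∩ upperBoundaryAt (intVec z)))) := by
  classical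
  obtain ⟨Λ, hΛ⟩ := hφ.exists_represents
  rw [hΛ.convexRingExt_eq hφ (mem_extendedConvexRing_inter hF hW)]
  have e : (F ∩ W).indicator (1 : Euc n → ℝ) =
      ∑ z ∈ T, ((F ∩ (W ∩ cubeAt (intVec z))).indicator (1 : Euc n → ℝ) -
        (F ∩ (W ∩ upperBoundaryAt (intVec z))).indicator (1 : Euc n → ℝ)) := by
    -- The difference of the two indicators is that of a half-open cube, and these cubes are
    -- disjoint.
    have hdiff : ∀ z : Fin n → ℤ, (F ∩ (W ∩ cubeAt (intVec z))).indicator (1 : Euc n → ℝ) -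
        (F ∩ (W ∩ upperBoundaryAt (intVec z))).indicator (1 : Euc n → ℝ) =
        (F ∩ W ∩ halfOpenCubeAt (intVec z)).indicator (1 : Euc n → ℝ) := by
      intro z
      ext x
      have hsub := @halfOpenCubeAt_subset n (intVec z) x
      by_cases hFx : x ∈ F <;> by_cases hWx : x ∈ W <;> by_cases h1 : x ∈ cubeAt (intVec z) <;>
        by_cases h2 : x ∈ halfOpenCubeAt (intVec z) <;>
        simp_all [indicator, upperBoundaryAt]
    simp_rw [hdiff]
    ext x
    rw [Finset.sum_apply]
    by_cases hx : x ∈ F ∩ W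
    · obtain ⟨z, hz, hxz⟩ := mem_iUnion₂.1 (hT hx.2)
      have hxz' : x ∈ F ∩ W ∩ halfOpenCubeAt (intVec z) := ⟨hx, hxz⟩
      rw [Finset.sum_eq_single_of_mem z hz, indicator_of_mem hx, indicator_of_mem hxz']
      intro w _ hwz
      refine indicator_of_notMem (fun h => hwz ?_) _
      rw [mem_halfOpenCubeAt_intVec.1 hxz, mem_halfOpenCubeAt_intVec.1 h.2]
    · rw [indicator_of_notMem hx]
      exact (Finset.sum_eq_zero fun z _ => indicator_of_notMem (fun h => hx h.1) _).symm
  rw [e, map_sum]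
  refine Finset.sum_congr rfl fun z _ => ?_
  rw [map_sub, hΛ.convexRingExt_eq hφ
      (mem_extendedConvexRing_inter hF (hW.inter (compactConvex_cubeAt _))),
    hΛ.convexRingExt_eq hφ (mem_convexRing_inter_upperBoundaryAt hF hW _)]

theorem IsStandardRandomSet.integral_eq_sum [IsProbabilityMeasure P]
    (hZ : IsStandardRandomSet P Z) (hφ : IsVal φ) {W : Set (Euc n)} (hW : CompactConvex W)
    (T : Finset (Fin n → ℤ)) (hT : W ⊆ ⋃ z ∈ T, halfOpenCubeAt (intVec z)) :
    ∫ ω, convexRingExt φ ((Z ω : Set (Euc n)) ∩ W) ∂P =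
      ∑ z ∈ T, (∫ ω, convexRingExt φ ((Z ω : Set (Euc n)) ∩ (W ∩ cubeAt (intVec z))) ∂P -
        ∫ ω, convexRingExt φ ((Z ω : Set (Euc n)) ∩ (W ∩ upperBoundaryAt (intVec z))) ∂P) := by
  have hI1 := fun z : Fin n → ℤ =>
    hZ.integrable hφ (hW.inter (compactConvex_cubeAt (intVec z)))
  have hI2 := fun z : Fin n → ℤ => hZ.integrable_inter_upperBoundaryAt hφ (intVec z) hW
  simp_rw [← fun z => integral_sub (hI1 z) (hI2 z)]
  refine Eq.trans (integral_congr_ae ?_) (integral_finsetSum _ fun z _ => (hI1 z).sub (hI2 z))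
  filter_upwards [hZ.ae_mem] with ω hω
  exact hφ.convexRingExt_eq_sum hω hW T hT

theorem IsStandardRandomSet.tendsto_mean_value [IsProbabilityMeasure P]
    (hZ : IsStandardRandomSet P Z) (hφ : IsVal φ) {K : Set (Euc n)} (hK : CompactConvex K)
    (hv : 0 < volume K) :
    Tendsto (fun r : ℝ => (∫ ω, convexRingExt φ ((Z ω : Set (Euc n)) ∩ r • K) ∂P) /
      (volume (r • K)).toReal) atTop (𝓝 (∫ ω, valueOnHalfOpenCube φ (Z ω : Set (Euc n)) ∂P)) := by
  classical
  obtain ⟨a, ha, hlat⟩ := exists_lattice_cubes hK hv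
  obtain ⟨c, hc0, hc⟩ := hZ.exists_bound_halfOpenCubeAt hφ
  rw [(hZ.integrable_valueOnHalfOpenCube hφ).2]
  set m := ∫ ω, convexRingExt φ ((Z ω : Set (Euc n)) ∩ cubeAt 0) ∂P -
    ∫ ω, convexRingExt φ ((Z ω : Set (Euc n)) ∩ upperBoundaryAt 0) ∂P with hm
  have key := tendsto_div_of_lattice_bounds (n := n)
    (f := fun r : ℝ => ∫ ω, convexRingExt φ ((Z ω : Set (Euc n)) ∩ r • K) ∂P) (m := m)
    (ENNReal.toReal_pos hv.ne' hK.1.measure_lt_top.ne) ha hc0 ?_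
  · refine key.congr' ?_
    filter_upwards [eventually_ge_atTop 0] with r hr
    rw [toReal_volume_smul hr]
  intro r hr
  obtain ⟨T, I, hIT, hcov, hI, hlow, hupp⟩ := hlat r hr
  refine ⟨I.card, T.card, by exact_mod_cast Finset.card_le_card hIT, hlow, hupp, ?_⟩
  have hrK : CompactConvex (r • K) := ⟨hK.1.smul r, hK.2.smul r⟩
  rw [hZ.integral_eq_sum hφ hrK T hcov, ← Finset.sum_sdiff hIT]
  -- For cubes inside `r • K` the window no longer matters, so stationarity gives the same value `m`
  -- for each; the cubes of `T \ I` form the error term.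
  have hsumI : ∑ z ∈ I, (∫ ω, convexRingExt φ ((Z ω : Set (Euc n)) ∩
      (r • K ∩ cubeAt (intVec z))) ∂P - ∫ ω, convexRingExt φ ((Z ω : Set (Euc n)) ∩
      (r • K ∩ upperBoundaryAt (intVec z))) ∂P) = I.card * m := by
    rw [← nsmul_eq_mul, ← Finset.sum_const]
    refine Finset.sum_congr rfl fun z hz => ?_
    have hzK := hI z hz
    have hzK' : upperBoundaryAt (intVec z) ⊆ r • K := sdiff_subset.trans hzK
    rw [inter_eq_right.2 hzK, inter_eq_right.2 hzK',
      hZ.integral_cubeAt hφ]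
  rw [hsumI, add_sub_cancel_right, ← Nat.cast_sub (Finset.card_le_card hIT),
    ← Finset.card_sdiff_of_subset hIT, ← nsmul_eq_mul]
  exact (Finset.abs_sum_le_sum_abs _ _).trans
    (Finset.sum_le_card_nsmul _ _ _ fun z _ => hc (intVec z) _ hrK)

end Limit

theorem mainTheorem5 {n : ℕ} (hn : 2 ≤ n)
    {Ω : Type*} [MeasurableSpace Ω] (P : Measure Ω) [IsProbabilityMeasure P]
    (Z : Ω → Closeds (Euc n)) (hZ : IsStationaryRandomClosedSet P Z)
    (hZS : ∀ᵐ ω ∂P, (Z ω : Set (Euc n)) ∈ extendedConvexRing n)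
    (hZN : ∫⁻ ω, (2 : ℝ≥0∞) ^
      minBodies ((Z ω : Set (Euc n)) ∩ Metric.closedBall (0 : Euc n) 1) ∂P < ∞)
    (φ : ConvexBody (Euc n) → ℝ) (hφ : IsVal φ) :
    IsAdditiveExtension φ (convexRingExt φ) ∧
    (∀ W : ConvexBody (Euc n),
      Integrable (fun ω => convexRingExt φ ((Z ω : Set (Euc n)) ∩ (W : Set (Euc n)))) P) ∧
    Integrable (fun ω => valueOnHalfOpenCube φ (Z ω : Set (Euc n))) P ∧
    ∀ K : ConvexBody (Euc n), 0 < volume (K : Set (Euc n)) →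
      Tendsto
        (fun r : ℝ =>
          (∫ ω, convexRingExt φ ((Z ω : Set (Euc n)) ∩ r • (K : Set (Euc n))) ∂P) /
            (volume (r • (K : Set (Euc n)))).toReal)
        atTop
        (𝓝 (∫ ω, valueOnHalfOpenCube φ (Z ω : Set (Euc n)) ∂P)) := by
  have hS : IsStandardRandomSet P Z := ⟨hZ, hZS, hZN⟩
  exact ⟨hφ.isAdditiveExtension, fun W => hS.integrable hφ W.compactConvex,
    (hS.integrable_valueOnHalfOpenCube hφ).1,
    fun K hK => hS.tendsto_mean_value hφ K.compactConvex hK⟩
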